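/- Let $\Gamma\subset O(4)$ be a finite group and let $f:\mathbb{R}^4\to\mathbb{R}^4$ be a $C^1$ vector field that is $\Gamma$-equivariant, i.e. $f(\gamma y)=\gamma f(y)$ for all $\gamma\in\Gamma$, $y\in\mathbb{R}^4$. A heteroclinic cycle $X$ of $\dot y=f(y)$ consists of equilibria (nodes) $\xi_1,\dots,\xi_m$, not all in the same $\Gamma$-orbit, together with, for each $i$ (indices modulo $m$), a non-constant trajectory $[\xi_i\to\xi_{i+1}]$ that tends to $\xi_i$ as $t\to-\infty$ and to $\xi_{i+1}$ as $t\to+\infty$. For a subgroup $\Sigma$ write $\mathrm{Fix}(\Sigma)=\{x\in\mathbb{R}^4:\sigma x=x \text{ for all }\sigma\in\Sigma\}$. The cycle is simple if $X\subset\mathbb{R}^4\setminus\{0\}$ and there are isotropy subgroups $\Sigma_i$ of $\Gamma$ such that, with $P_i=\mathrm{Fix}(\Sigma_i)$ and $L_i=P_{i-1}\cap P_i$, for every $i$: - $\dim P_i=2$; - $[\xi_i\to\xi_{i+1}]\subset P_i$, and in $P_i$ the equilibrium $\xi_i$ is a hyperbolic saddle and $\xi_{i+1}$ is a hyperbolic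 sink; - the group orbit $\Gamma X$ meets each connected component of $L_i\setminus\{0\}$ in at most one point; - $\mathrm{d}f(\xi_i)$ has no multiple eigenvalue. A simple network is a finite union $N$ of simple cycles that is connected and such that $\Gamma N$ meets each connected component of $L\setminus\{0\}$ in at most one point, for every $L$ among the spaces $L_i$ of its cycles. It satisfies Assumption A if (i) every cycle of the network has an elementary building block, i.e. a run of $k\ge1$ consecutive connections $[\xi_i\to\cdots\to\xi_{i+k}]$ with $\xi_{i+k}=\xi_i$ such that no two of $\xi_i,\dots,\xi_{i+k-1}$ lie in the same $\Gamma$-orbit; and (ii) every node of the network lies on a coordinate axis of $\mathbb{R}^4$. Then any two cycles of a simple network in $\mathbb{R}^4$ satisfying Assumption A have at least one connecting trajectory in common, up to symmetry: there are a connecting trajectory $\kappa$ of the first cycle, a connecting trajectory $\kappa'$ of the second, and $\gamma\in\Gamma$ with $\gamma\kappa=\kappa'$. -/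

import Mathlib

open Set Filter Topology

/-- Euclidean `ℝ⁴`. -/
abbrev E4 : Type := EuclideanSpace ℝ (Fin 4)

/-- The orthogonal group `O(4)`. -/
abbrev O4 : Type := E4 ≃ₗᵢ[ℝ] E4

/-- `f (γ y) = γ (f y)` for all `γ ∈ Γ` and all `y`. -/
def IsEquivariant (Γ : Subgroup O4) (f : E4 → E4) : Prop :=
  ∀ γ ∈ Γ, ∀ y : E4, f (γ y) = γ (f y)

/-- `x` belongs to the group orbit `Γ y`. -/
def InOrbit (Γ : Subgroup O4) (x y : E4) : Prop :=
  ∃ γ ∈ Γ, x = γ y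

/-- The union of all images `γ S`, `γ ∈ Γ`. -/
def orbitSet (Γ : Subgroup O4) (S : Set E4) : Set E4 :=
  {x | ∃ γ ∈ Γ, ∃ s ∈ S, x = γ s}

/-- `S` is an isotropy subgroup of `Γ`: the group of all elements of `Γ` that fix some point `x`. -/
def IsIsotropySubgroup (Γ S : Subgroup O4) : Prop :=
  ∃ x : E4, ∀ γ : O4, γ ∈ S ↔ γ ∈ Γ ∧ γ x = x

/-- The fixed-point space `Fix(S)`. -/
def fixedSpace (S : Subgroup O4) : Submodule ℝ E4 where
  carrier := {x | ∀ γ ∈ S, γ x = x}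
  add_mem' := by
    intro a b ha hb γ hγ
    rw [map_add, ha γ hγ, hb γ hγ]
  zero_mem' := by
    intro γ _
    exact map_zero γ
  smul_mem' := by
    intro c x hx γ hγ
    rw [map_smul, hx γ hγ]

/-- `μ` is a (complex) eigenvalue of the restriction of `A` to the `A`-invariant subspace `P`:
there is a non-zero eigenvector `u + i v` of `A` in the complexification of `P`. -/
def IsEigenvalueOn (A : E4 →L[ℝ] E4) (P : Submodule ℝ E4) (μ : ℂ) : Prop :=
  ∃ u ∈ P, ∃ v ∈ P, (u ≠ 0 ∨ v ≠ 0) ∧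
    A u = μ.re • u - μ.im • v ∧ A v = μ.im • u + μ.re • v

/-- The equilibrium `ξ` is a (hyperbolic) sink for the flow of `f` restricted to the invariant
subspace `P`. -/
def IsSinkIn (f : E4 → E4) (P : Submodule ℝ E4) (ξ : E4) : Prop :=
  ∀ μ : ℂ, IsEigenvalueOn (fderiv ℝ f ξ) P μ → μ.re < 0

/-- The equilibrium `ξ` is a (hyperbolic) saddle for the flow of `f` restricted to the invariant
subspace `P`. -/
def IsSaddleIn (f : E4 → E4) (P : Submodule ℝ E4) (ξ : E4) : Prop :=
  (∀ μ : ℂ, IsEigenvalueOn (fderiv ℝ f ξ) P μ → μ.re ≠ 0) ∧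
  (∃ μ : ℂ, IsEigenvalueOn (fderiv ℝ f ξ) P μ ∧ 0 < μ.re) ∧
  (∃ μ : ℂ, IsEigenvalueOn (fderiv ℝ f ξ) P μ ∧ μ.re < 0)

/-- `S` meets each connected component of `L \ {0}` in at most one point. -/
def MeetsComponentsAtMostOnce (S : Set E4) (L : Submodule ℝ E4) : Prop :=
  ∀ x ∈ (L : Set E4) \ {0}, (connectedComponentIn ((L : Set E4) \ {0}) x ∩ S).Subsingleton

/-- A heteroclinic cycle of `y' = f y`: equilibria `ξ_i` and non-constant trajectories
`[ξ_i → ξ_{i+1}]`, indexed cyclically, such that the equilibria do not all lie in one `Γ`-orbit. -/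
structure HeteroclinicCycle (Γ : Subgroup O4) (f : E4 → E4) where
  len : ℕ
  len_pos : 0 < len
  node : ZMod len → E4
  traj : ZMod len → ℝ → E4
  equilibrium : ∀ i, f (node i) = 0
  solution : ∀ i t, HasDerivAt (traj i) (f (traj i t)) t
  nonconstant : ∀ i, ∃ t, traj i t ≠ node i
  from_node : ∀ i, Tendsto (traj i) atBot (𝓝 (node i))
  to_node : ∀ i, Tendsto (traj i) atTop (𝓝 (node (i + 1)))
  not_homoclinic : ∃ i, ¬ InOrbit Γ (node i) (node 0)

namespace HeteroclinicCycle

variable {Γ : Subgroup O4} {f : E4 → E4}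

/-- The connecting trajectory `[ξ_i → ξ_{i+1}]` as a subset of `ℝ⁴`. -/
def connection (X : HeteroclinicCycle Γ f) (i : ZMod X.len) : Set E4 :=
  range (X.traj i)

/-- The union of the nodes and the connecting trajectories. -/
def carrier (X : HeteroclinicCycle Γ f) : Set E4 :=
  range X.node ∪ ⋃ i, X.connection i

/-- The `k` consecutive connections that start at `ξ_i` form a building block
`[ξ_i → ⋯ → ξ_{i+k}]` with `ξ_{i+k} = γ ξ_i`. -/
def IsBuildingBlock (X : HeteroclinicCycle Γ f) (i : ZMod X.len) (k : ℕ) (γ : O4) : Prop :=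
  1 ≤ k ∧ γ ∈ Γ ∧ X.node (i + k) = γ (X.node i) ∧
    ∀ l : ℕ, 1 ≤ l → l < k → ¬ InOrbit Γ (X.node (i + l)) (X.node i)

/-- The cycle has an elementary building block: `γ = Id`, and no two of the nodes
`ξ_i, …, ξ_{i+k-1}` lie in the same group orbit. -/
def HasElementaryBuildingBlock (X : HeteroclinicCycle Γ f) : Prop :=
  ∃ (i : ZMod X.len) (k : ℕ), X.IsBuildingBlock i k 1 ∧
    ∀ l l' : ℕ, l < k → l' < k → l ≠ l' → ¬ InOrbit Γ (X.node (i + l)) (X.node (i + l'))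

end HeteroclinicCycle

/-- A simple robust heteroclinic cycle in `ℝ⁴ \ {0}`. The cycle is understood together with its
images under `Γ` where its intersection with `L_i \ {0}` is concerned. -/
structure SimpleCycle (Γ : Subgroup O4) (f : E4 → E4) extends HeteroclinicCycle Γ f where
  /-- the isotropy subgroups `Σ_i`, with `P_i = Fix(Σ_i)` -/
  iso : ZMod len → Subgroup O4
  iso_isotropy : ∀ i, IsIsotropySubgroup Γ (iso i)
  /-- `dim P_i = 2` -/
  finrank_plane : ∀ i, Module.finrank ℝ (fixedSpace (iso i)) = 2
  /-- `[ξ_i → ξ_{i+1}]` is a saddle-sink connection in `P_i` -/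
  traj_mem : ∀ i t, traj i t ∈ fixedSpace (iso i)
  saddle : ∀ i, IsSaddleIn f (fixedSpace (iso i)) (node i)
  sink : ∀ i, IsSinkIn f (fixedSpace (iso i)) (node (i + 1))
  zero_notMem : (0 : E4) ∉ toHeteroclinicCycle.carrier
  /-- with `L_i = P_{i-1} ∩ P_i` -/
  meets_line : ∀ i, MeetsComponentsAtMostOnce (orbitSet Γ toHeteroclinicCycle.carrier)
    (fixedSpace (iso (i - 1)) ⊓ fixedSpace (iso i))
  /-- the linearization at a node has no multiple (complex) eigenvalues -/
  no_double_eigenvalue : ∀ i,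
    (LinearMap.charpoly (fderiv ℝ f (node i) : E4 →ₗ[ℝ] E4)).Separable

namespace SimpleCycle

variable {Γ : Subgroup O4} {f : E4 → E4}

/-- `P_i = Fix(Σ_i)`. -/
def plane (X : SimpleCycle Γ f) (i : ZMod X.len) : Submodule ℝ E4 :=
  fixedSpace (X.iso i)

/-- `L_i = P_{i-1} ∩ P_i`. -/
def line (X : SimpleCycle Γ f) (i : ZMod X.len) : Submodule ℝ E4 :=
  X.plane (i - 1) ⊓ X.plane i

end SimpleCycle

/-- A simple heteroclinic network: a finite connected union of simple cycles such that the network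
(with its images under `Γ`) meets each connected component of each `L \ {0}`, for `L` any of the
lines `L_i` of any of its cycles, in at most one point. -/
structure SimpleNetwork (Γ : Subgroup O4) (f : E4 → E4) where
  card : ℕ
  cycle : Fin card → SimpleCycle Γ f
  connected : IsConnected (⋃ c, (cycle c).carrier)
  meets_line : ∀ c i,
    MeetsComponentsAtMostOnce (orbitSet Γ (⋃ d, (cycle d).carrier)) ((cycle c).line i)

/-- `x` lies on one of the four coordinate axes. -/
def OnCoordinateAxis (x : E4) : Prop :=
  ∃ k : Fin 4, ∀ l : Fin 4, l ≠ k → x l = 0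

/-- Assumption A: every cycle has at least one elementary building block, and every equilibrium of
the network is on a coordinate axis. -/
def SimpleNetwork.AssumptionA {Γ : Subgroup O4} {f : E4 → E4} (N : SimpleNetwork Γ f) : Prop :=
  (∀ c, (N.cycle c).HasElementaryBuildingBlock) ∧
  (∀ c i, OnCoordinateAxis ((N.cycle c).node i))

/-- Two cycles have a connecting trajectory in common, up to the action of `Γ`. -/
def HaveCommonConnection {Γ : Subgroup O4} {f : E4 → E4} (X Y : HeteroclinicCycle Γ f) : Prop :=
  ∃ (i : ZMod X.len) (j : ZMod Y.len), ∃ γ ∈ Γ, (fun x => γ x) '' X.connection i = Y.connection j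

/-! The proof shows that any two cycles share a node up to symmetry, and that a shared node forces a
shared connection.

Shared node to shared connection (`haveCommonConnection_of_node`). At a node `ξ` the vector `ξ`, the
incoming plane and the outgoing plane carry eigenvectors with eigenvalues `r`, `a < 0` and `b > 0`.
Two cycles through `ξ` would give five eigenvalues in dimension four, so `a = a'` or `b = b'`; as
eigenvalues are simple, the incoming or the outgoing planes agree (`plane_eq_or_plane_eq`). In a
common outgoing plane the two branches of the unstable manifold are swapped by a symmetry
(`exists_image_eq_of_source_eq`). In a common incoming plane, the line through each saddle is
invariant and acts as a barrier for the other connection, which forces both saddles onto one ray, up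
to symmetry; there they coincide (`exists_image_eq_of_target_eq`).

Existence of a shared node. Consecutive nodes on coordinate axes are either orthogonal, and then
both can be mapped to their negatives by `Γ`, or opposite on one axis. If every node can be so
reversed, nodes on the same axis are equivalent; an elementary building block then meets at least
three axes, and two triples of axes among four overlap. If some node cannot be reversed, its cycle
never leaves its axis; by connectedness neither does any other cycle, and each cycle visits both
half-axes. -/

/-! ### Uniqueness of solutions. -/

/-- Two global solutions of an autonomous equation with `C¹` right-hand side that agree at one time
agree at all times. -/
theorem solution_eq_of_eq_at {E : Type*} [NormedAddCommGroup E] [NormedSpace ℝ E] {f : E → E}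
    (hf : ContDiff ℝ 1 f) {x y : ℝ → E}
    (hx : ∀ t, HasDerivAt x (f (x t)) t) (hy : ∀ t, HasDerivAt y (f (y t)) t)
    {t₀ : ℝ} (h : x t₀ = y t₀) (t : ℝ) : x t = y t := by
  have hxc : Continuous x := continuous_iff_continuousAt.2 fun t => (hx t).continuousAt
  have hyc : Continuous y := continuous_iff_continuousAt.2 fun t => (hy t).continuousAt
  have hclopen : IsClopen {t | x t = y t} := by
    refine ⟨isClosed_eq hxc hyc, isOpen_iff_mem_nhds.2 fun s hs => ?_⟩
    -- A `C¹` field is Lipschitz near `x s`, so local uniqueness makes the set of agreement times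
    -- open.
    obtain ⟨K, U, hU, hK⟩ := (hf.contDiffAt (x := x s)).exists_lipschitzOnWith
    refine ODE_solution_unique_of_eventually (v := fun _ => f) (s := fun _ => U) (K := K)
      (Eventually.of_forall fun _ => hK) ?_ ?_ hs
    · filter_upwards [hxc.continuousAt.preimage_mem_nhds hU] with t ht using ⟨hx t, ht⟩
    · filter_upwards [hyc.continuousAt.preimage_mem_nhds (hs ▸ hU)] with t ht using ⟨hy t, ht⟩
  have := hclopen.eq_univ ⟨t₀, h⟩
  exact (this.symm ▸ mem_univ t : t ∈ {t | x t = y t})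

/-- Two solutions whose orbits meet differ by a time shift. -/
theorem solution_shift_eq {E : Type*} [NormedAddCommGroup E] [NormedSpace ℝ E] {f : E → E}
    (hf : ContDiff ℝ 1 f) {x y : ℝ → E}
    (hx : ∀ t, HasDerivAt x (f (x t)) t) (hy : ∀ t, HasDerivAt y (f (y t)) t)
    {s t : ℝ} (h : x s = y t) (τ : ℝ) : x (τ + s) = y (τ + t) := by
  refine solution_eq_of_eq_at hf (x := fun τ => x (τ + s)) (y := fun τ => y (τ + t)) (t₀ := 0)
    (fun τ => (hx _).comp_add_const _ _) (fun τ => (hy _).comp_add_const _ _) (by simpa using h) τ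

/-- A solution through an equilibrium is constant. -/
theorem solution_const_of_equilibrium {E : Type*} [NormedAddCommGroup E] [NormedSpace ℝ E]
    {f : E → E} (hf : ContDiff ℝ 1 f) {x : ℝ → E} (hx : ∀ t, HasDerivAt x (f (x t)) t)
    {s : ℝ} (h : f (x s) = 0) (t : ℝ) : x t = x s :=
  solution_eq_of_eq_at hf (y := fun _ => x s) hx (fun t => h ▸ hasDerivAt_const t (x s)) rfl t

/-! ### Symmetries acting on solutions and linearizations. -/

/-- The image of a solution under a symmetry is a solution. -/
theorem IsEquivariant.solution_comp {Γ : Subgroup O4} {f : E4 → E4} (h : IsEquivariant Γ f)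
    {γ : O4} (hγ : γ ∈ Γ) {x : ℝ → E4} (hx : ∀ t, HasDerivAt x (f (x t)) t) (t : ℝ) :
    HasDerivAt (fun t => γ (x t)) (f (γ (x t))) t := by
  rw [h γ hγ]
  exact (γ.toContinuousLinearEquiv : E4 →L[ℝ] E4).hasFDerivAt.comp_hasDerivAt t (hx t)

/-- The linearization at `γ ξ` is conjugate to the one at `ξ`. -/
theorem IsEquivariant.fderiv_apply {Γ : Subgroup O4} {f : E4 → E4} (h : IsEquivariant Γ f)
    (hf : ContDiff ℝ 1 f) {γ : O4} (hγ : γ ∈ Γ) (ξ v : E4) :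
    fderiv ℝ f (γ ξ) (γ v) = γ (fderiv ℝ f ξ v) := by
  have hd : Differentiable ℝ f := hf.differentiable (by norm_num)
  have hγd (y : E4) : HasFDerivAt (fun z => γ z) (γ.toContinuousLinearEquiv : E4 →L[ℝ] E4) y :=
    (γ.toContinuousLinearEquiv : E4 →L[ℝ] E4).hasFDerivAt
  have h1 : HasFDerivAt (fun y => f (γ y)) _ ξ := (hd (γ ξ)).hasFDerivAt.comp ξ (hγd ξ)
  have h2 : HasFDerivAt (fun y => γ (f y)) _ ξ := (hγd (f ξ)).comp ξ (hd ξ).hasFDerivAt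
  have : (fun y => f (γ y)) = fun y => γ (f y) := funext fun y => h γ hγ y
  rw [this] at h1
  exact DFunLike.congr_fun (h1.unique h2) v

/-! ### Simple eigenvalues and eigenframes of invariant planes. -/

/-- An endomorphism with separable characteristic polynomial has at most one-dimensional
generalized eigenspaces. -/
theorem finrank_maxGenEigenspace_le_one {A : E4 →ₗ[ℝ] E4} (hA : A.charpoly.Separable) (μ : ℝ) :
    Module.finrank ℝ (Module.End.maxGenEigenspace A μ) ≤ 1 := by
  rw [LinearMap.finrank_maxGenEigenspace_eq]
  exact Polynomial.rootMultiplicity_le_one_of_separable hA μ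

/-- Generalized eigenvectors are allowed so that Jordan blocks are excluded as well, as needed for
`β ≠ r` in `exists_isFrame`. -/
theorem exists_smul_eq_of_mem_maxGenEigenspace {A : E4 →ₗ[ℝ] E4} (hA : A.charpoly.Separable)
    {μ : ℝ} {v w : E4} (hv0 : v ≠ 0) (hv : v ∈ Module.End.maxGenEigenspace A μ)
    (hw : w ∈ Module.End.maxGenEigenspace A μ) : ∃ s : ℝ, w = s • v := by
  obtain ⟨u, hu⟩ := finrank_le_one_iff.1 (finrank_maxGenEigenspace_le_one hA μ)
  obtain ⟨a, ha⟩ := hu ⟨v, hv⟩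
  obtain ⟨b, hb⟩ := hu ⟨w, hw⟩
  have ha' : a • (u : E4) = v := congrArg Subtype.val ha
  have hb' : b • (u : E4) = w := congrArg Subtype.val hb
  have ha0 : a ≠ 0 := by rintro rfl; exact hv0 (by rw [← ha', zero_smul])
  refine ⟨b / a, ?_⟩
  rw [← ha', ← hb', smul_smul, div_mul_cancel₀ _ ha0]

theorem mem_maxGenEigenspace_of_eigenvector {A : E4 →ₗ[ℝ] E4} {μ : ℝ} {v : E4}
    (hv : A v = μ • v) : v ∈ Module.End.maxGenEigenspace A μ :=
  Module.End.mem_maxGenEigenspace A μ v |>.2 ⟨1, by simp [hv]⟩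

/-- A plane through `ξ ≠ 0` is spanned by `ξ` and a vector orthogonal to it. -/
theorem exists_orthogonal_spanning {P : Submodule ℝ E4} (hP : Module.finrank ℝ P = 2) {ξ : E4}
    (hξ : ξ ∈ P) (hξ0 : ξ ≠ 0) :
    ∃ p ∈ P, p ≠ 0 ∧ inner ℝ p ξ = 0 ∧ ∀ w ∈ P, ∃ s t : ℝ, w = s • ξ + t • p := by
  have hle : Submodule.span ℝ {ξ} ≤ P := by simpa using hξ
  have hlt : Submodule.span ℝ {ξ} < P := by
    refine lt_of_le_of_ne hle fun h => ?_
    rw [← h, finrank_span_singleton hξ0] at hP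
    omega
  obtain ⟨w, hw, hwn⟩ := SetLike.exists_of_lt hlt
  have hξξ : inner ℝ ξ ξ ≠ 0 := inner_self_ne_zero.2 hξ0
  set p := w - (inner ℝ w ξ / inner ℝ ξ ξ : ℝ) • ξ with hp
  have hpP : p ∈ P := P.sub_mem hw (P.smul_mem _ hξ)
  have hp0 : p ≠ 0 := by
    intro h
    exact hwn (Submodule.mem_span_singleton.2 ⟨_, (sub_eq_zero.1 (hp ▸ h)).symm⟩)
  have hpξ : inner ℝ p ξ = 0 := by
    rw [hp, inner_sub_left, inner_smul_left]
    simp only [conj_trivial]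
    rw [div_mul_cancel₀ _ hξξ, sub_self]
  have hli : LinearIndependent ℝ ![ξ, p] := by
    rw [LinearIndependent.pair_iff]
    intro s t h
    have h1 := congrArg (fun z => inner ℝ z ξ) h
    have h2 := congrArg (fun z => inner ℝ z p) h
    simp only [inner_add_left, inner_smul_left, conj_trivial, inner_zero_left, hpξ,
      real_inner_comm p ξ, mul_zero, add_zero, zero_add] at h1 h2
    exact ⟨(mul_eq_zero.1 h1).resolve_right hξξ,
      (mul_eq_zero.1 h2).resolve_right (inner_self_ne_zero.2 hp0)⟩
  refine ⟨p, hpP, hp0, hpξ, fun w hw => ?_⟩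
  have hspan : Submodule.span ℝ {ξ, p} = P := by
    refine Submodule.eq_of_le_of_finrank_le (Submodule.span_le.2 ?_) ?_
    · rintro z (rfl | rfl)
      exacts [hξ, hpP]
    · have := finrank_span_eq_card hli
      rw [Matrix.range_cons_cons_empty] at this
      rw [hP, this, Fintype.card_fin]
  rw [← hspan, Submodule.mem_span_pair] at hw
  obtain ⟨s, t, h⟩ := hw
  exact ⟨s, t, h.symm⟩

/-- At the point `ξ ≠ 0` of the plane `P`, the linearization of `f` is diagonal on `P` in the
orthogonal basis `ξ`, `v`, with distinct eigenvalues `r` and `β`, and some symmetry fixes `ξ` and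
reverses `v`. -/
structure IsFrame (Γ : Subgroup O4) (f : E4 → E4) (P : Submodule ℝ E4) (ξ v : E4) (r β : ℝ) :
    Prop where
  base_mem : ξ ∈ P
  base_ne : ξ ≠ 0
  dir_mem : v ∈ P
  dir_ne : v ≠ 0
  orth : inner ℝ v ξ = 0
  spans : ∀ w ∈ P, ∃ s t : ℝ, w = s • ξ + t • v
  base_eig : fderiv ℝ f ξ ξ = r • ξ
  dir_eig : fderiv ℝ f ξ v = β • v
  eig_ne : β ≠ r
  flip : ∃ g ∈ Γ, g ξ = ξ ∧ g v = -v

namespace IsFrame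

variable {Γ : Subgroup O4} {f : E4 → E4} {P : Submodule ℝ E4} {ξ v : E4} {r β : ℝ}

theorem inner_base_self (F : IsFrame Γ f P ξ v r β) : inner ℝ ξ ξ ≠ 0 :=
  inner_self_ne_zero.2 F.base_ne

theorem inner_dir_self (F : IsFrame Γ f P ξ v r β) : inner ℝ v v ≠ 0 :=
  inner_self_ne_zero.2 F.dir_ne

theorem inner_base_dir (F : IsFrame Γ f P ξ v r β) : inner ℝ ξ v = 0 := by
  rw [real_inner_comm, F.orth]

/-- A combination of the frame vectors vanishes only trivially. -/
theorem coeff_eq_zero (F : IsFrame Γ f P ξ v r β) {s t : ℝ} (h : s • ξ + t • v = 0) :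
    s = 0 ∧ t = 0 := by
  have h1 := congrArg (fun z => inner ℝ z ξ) h
  have h2 := congrArg (fun z => inner ℝ z v) h
  simp only [inner_add_left, inner_smul_left, conj_trivial, inner_zero_left, F.orth,
    F.inner_base_dir, mul_zero, add_zero, zero_add] at h1 h2
  exact ⟨(mul_eq_zero.1 h1).resolve_right F.inner_base_self,
    (mul_eq_zero.1 h2).resolve_right F.inner_dir_self⟩

theorem dir_of_inner_eq_zero (F : IsFrame Γ f P ξ v r β) {w : E4} (hw : w ∈ P)
    (h : inner ℝ w ξ = 0) : ∃ t : ℝ, w = t • v := by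
  obtain ⟨s, t, rfl⟩ := F.spans w hw
  simp only [inner_add_left, inner_smul_left, conj_trivial, F.orth, mul_zero, add_zero] at h
  rw [(mul_eq_zero.1 h).resolve_right F.inner_base_self]
  exact ⟨t, by simp⟩

/-- An element of `P` orthogonal to `v` is a multiple of `ξ`. -/
theorem base_of_inner_eq_zero (F : IsFrame Γ f P ξ v r β) {w : E4} (hw : w ∈ P)
    (h : inner ℝ w v = 0) : ∃ s : ℝ, w = s • ξ := by
  obtain ⟨s, t, rfl⟩ := F.spans w hw
  simp only [inner_add_left, inner_smul_left, conj_trivial, F.inner_base_dir, mul_zero,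
    zero_add] at h
  rw [(mul_eq_zero.1 h).resolve_right F.inner_dir_self]
  exact ⟨s, by simp⟩

/-- The plane of a frame is determined by its two vectors. -/
theorem plane_eq (F : IsFrame Γ f P ξ v r β) {P' : Submodule ℝ E4} {v' : E4} {r' β' : ℝ}
    (F' : IsFrame Γ f P' ξ v' r' β') {s : ℝ} (h : v' = s • v) : P = P' := by
  have hs : s ≠ 0 := by rintro rfl; exact F'.dir_ne (by simp [h])
  have hv : v = s⁻¹ • v' := by rw [h, smul_smul, inv_mul_cancel₀ hs, one_smul]
  ext w
  constructor
  · intro hw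
    obtain ⟨a, b, rfl⟩ := F.spans w hw
    rw [hv]
    exact P'.add_mem (P'.smul_mem _ F'.base_mem) (P'.smul_mem _ (P'.smul_mem _ F'.dir_mem))
  · intro hw
    obtain ⟨a, b, rfl⟩ := F'.spans w hw
    rw [h]
    exact P.add_mem (P.smul_mem _ F.base_mem) (P.smul_mem _ (P.smul_mem _ F.dir_mem))

/-- The real parts of the eigenvalues on the plane are `r` and `β`. -/
theorem re_eq_of_isEigenvalueOn (F : IsFrame Γ f P ξ v r β) {μ : ℂ}
    (hμ : IsEigenvalueOn (fderiv ℝ f ξ) P μ) : μ.re = r ∨ μ.re = β := by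
  obtain ⟨u, hu, w, hw, hne, h1, h2⟩ := hμ
  obtain ⟨a, b, rfl⟩ := F.spans u hu
  obtain ⟨c, d, rfl⟩ := F.spans w hw
  simp only [map_add, map_smul, F.base_eig, F.dir_eig] at h1 h2
  have e1 := F.coeff_eq_zero (s := (r - μ.re) * a + μ.im * c) (t := (β - μ.re) * b + μ.im * d) (by
    rw [← sub_eq_zero] at h1
    rw [← h1]; module)
  have e2 := F.coeff_eq_zero (s := (r - μ.re) * c - μ.im * a) (t := (β - μ.re) * d - μ.im * b) (by
    rw [← sub_eq_zero] at h2
    rw [← h2]; module)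
  by_contra! hcon
  -- The terms with `μ.im` cancel in these combinations, leaving sums of squares.
  have ha : (r - μ.re) * (a ^ 2 + c ^ 2) = 0 := by linear_combination a * e1.1 + c * e2.1
  have hb : (β - μ.re) * (b ^ 2 + d ^ 2) = 0 := by linear_combination b * e1.2 + d * e2.2
  replace ha := (mul_eq_zero.1 ha).resolve_left (sub_ne_zero.2 hcon.1.symm)
  replace hb := (mul_eq_zero.1 hb).resolve_left (sub_ne_zero.2 hcon.2.symm)
  have ha0 : a = 0 := by nlinarith
  have hc0 : c = 0 := by nlinarith
  have hb0 : b = 0 := by nlinarith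
  have hd0 : d = 0 := by nlinarith
  simp [ha0, hb0, hc0, hd0] at hne

theorem isEigenvalueOn_base (F : IsFrame Γ f P ξ v r β) :
    IsEigenvalueOn (fderiv ℝ f ξ) P r :=
  ⟨ξ, F.base_mem, 0, P.zero_mem, Or.inl F.base_ne, by simp [F.base_eig], by simp⟩

theorem isEigenvalueOn_dir (F : IsFrame Γ f P ξ v r β) :
    IsEigenvalueOn (fderiv ℝ f ξ) P β :=
  ⟨v, F.dir_mem, 0, P.zero_mem, Or.inl F.dir_ne, by simp [F.dir_eig], by simp⟩

/-- The image of a frame under a symmetry. -/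
theorem map (F : IsFrame Γ f P ξ v r β) (hf : ContDiff ℝ 1 f) (h : IsEquivariant Γ f) {γ : O4}
    (hγ : γ ∈ Γ) :
    IsFrame Γ f (P.map (γ.toLinearEquiv : E4 →ₗ[ℝ] E4)) (γ ξ) (γ v) r β where
  base_mem := ⟨ξ, F.base_mem, rfl⟩
  base_ne := by simpa using F.base_ne
  dir_mem := ⟨v, F.dir_mem, rfl⟩
  dir_ne := by simpa using F.dir_ne
  orth := by rw [LinearIsometryEquiv.inner_map_map, F.orth]
  spans := by
    rintro _ ⟨w, hw, rfl⟩
    obtain ⟨s, t, rfl⟩ := F.spans w hw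
    exact ⟨s, t, by simp⟩
  base_eig := by rw [h.fderiv_apply hf hγ, F.base_eig, map_smul]
  dir_eig := by rw [h.fderiv_apply hf hγ, F.dir_eig, map_smul]
  eig_ne := F.eig_ne
  flip := by
    obtain ⟨g, hg, h1, h2⟩ := F.flip
    refine ⟨γ * g * γ⁻¹, Γ.mul_mem (Γ.mul_mem hγ hg) (Γ.inv_mem hγ), ?_, ?_⟩
    · simp [h1]
    · simp [h2]

end IsFrame

/-- Two fixed-point planes of subgroups of `Γ` that intersect in the line through the point `ξ`
fixed by both: each of them carries a frame at `ξ`, as the linearization has simple eigenvalues. -/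
theorem exists_isFrame {Γ : Subgroup O4} {f : E4 → E4} (hf : ContDiff ℝ 1 f)
    (h : IsEquivariant Γ f) {S T : Subgroup O4} (hS : S ≤ Γ) (hT : T ≤ Γ) {ξ : E4} (hξ0 : ξ ≠ 0)
    (hP : Module.finrank ℝ (fixedSpace S) = 2)
    (hST : fixedSpace S ⊓ fixedSpace T = Submodule.span ℝ {ξ})
    (hsep : (LinearMap.charpoly (fderiv ℝ f ξ : E4 →ₗ[ℝ] E4)).Separable) :
    ∃ v r β, IsFrame Γ f (fixedSpace S) ξ v r β := by
  have hξST : ξ ∈ fixedSpace S ⊓ fixedSpace T := hST ▸ Submodule.mem_span_singleton_self ξ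
  obtain ⟨hξS, hξT⟩ := hξST
  have hinv : ∀ {R : Subgroup O4}, R ≤ Γ → ξ ∈ fixedSpace R →
      ∀ γ ∈ R, ∀ w, fderiv ℝ f ξ (γ w) = γ (fderiv ℝ f ξ w) := by
    intro R hR hξR γ hγ w
    have := h.fderiv_apply hf (hR hγ) ξ w
    rwa [hξR γ hγ] at this
  have hmaps : ∀ {R : Subgroup O4}, R ≤ Γ → ξ ∈ fixedSpace R →
      ∀ w ∈ fixedSpace R, fderiv ℝ f ξ w ∈ fixedSpace R := by
    intro R hR hξR w hw γ hγ
    rw [← hinv hR hξR γ hγ, hw γ hγ]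
  -- The linearization preserves both fixed-point spaces, hence their intersection, the line through
  -- `ξ`.
  obtain ⟨r, hr⟩ : ∃ r : ℝ, r • ξ = fderiv ℝ f ξ ξ :=
    Submodule.mem_span_singleton.1 (hST ▸ ⟨hmaps hS hξS ξ hξS, hmaps hT hξT ξ hξT⟩)
  obtain ⟨p, hpP, hp0, hpξ, hspan⟩ := exists_orthogonal_spanning hP hξS hξ0
  obtain ⟨α, β, hAp⟩ := hspan _ (hmaps hS hξS p hpP)
  have hindep : ∀ s t : ℝ, s • ξ + t • p = 0 → t = 0 := by
    intro s t hst
    have := congrArg (fun z => inner ℝ z p) hst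
    simp only [inner_add_left, inner_smul_left, conj_trivial, inner_zero_left,
      real_inner_comm p ξ, hpξ, mul_zero, zero_add] at this
    exact (mul_eq_zero.1 this).resolve_right (inner_self_ne_zero.2 hp0)
  -- On the plane the linearization is triangular in the basis `ξ`, `p`; equal diagonal entries
  -- would give a two-dimensional generalized eigenspace.
  have hβr : β ≠ r := by
    rintro rfl
    have h1 : p ∈ Module.End.maxGenEigenspace (fderiv ℝ f ξ : E4 →ₗ[ℝ] E4) β := by
      refine (Module.End.mem_maxGenEigenspace _ _ _).2 ⟨2, ?_⟩
      simp [pow_two, hAp, ← hr]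
    obtain ⟨s, hs⟩ := exists_smul_eq_of_mem_maxGenEigenspace hsep hξ0
      (mem_maxGenEigenspace_of_eigenvector hr.symm) h1
    have := hindep (-s) 1 (by rw [hs]; module)
    norm_num at this
  -- the eigenvector for `β`
  have hsub : β - r ≠ 0 := sub_ne_zero.2 hβr
  set v := (α / (β - r)) • ξ + p with hv
  have hvP : v ∈ fixedSpace S := Submodule.add_mem _ (Submodule.smul_mem _ _ hξS) hpP
  have hv0 : v ≠ 0 := by
    intro h0
    have := hindep (α / (β - r)) 1 (by rw [one_smul, ← hv, h0])
    norm_num at this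
  have hAv : fderiv ℝ f ξ v = β • v := by
    rw [hv, map_add, map_smul, ← hr, hAp, smul_add, smul_smul, smul_smul, ← add_assoc, ← add_smul]
    congr 2
    field_simp
    ring
  have hvT : v ∉ fixedSpace T := by
    intro hvT
    have : v ∈ Submodule.span ℝ {ξ} := hST ▸ ⟨hvP, hvT⟩
    obtain ⟨s, hs⟩ := Submodule.mem_span_singleton.1 this
    have := hindep (α / (β - r) - s) 1 (by
      rw [one_smul, sub_smul, hs, sub_add_eq_add_sub, ← hv, sub_self])
    norm_num at this
  -- The flip comes from the other group: `T` fixes `ξ` but not `v`, and its elements commute with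
  -- the linearization, so they act on the simple eigenline of `v` by a sign.
  obtain ⟨g, hg, hgv⟩ : ∃ g ∈ T, g v ≠ v := by
    by_contra! hcon
    exact hvT hcon
  have hgv' : g v = -v := by
    have hmem : fderiv ℝ f ξ (g v) = β • g v := by
      rw [hinv hT hξT g hg, hAv, map_smul]
    obtain ⟨s, hs⟩ := exists_smul_eq_of_mem_maxGenEigenspace hsep hv0
      (mem_maxGenEigenspace_of_eigenvector hAv) (mem_maxGenEigenspace_of_eigenvector hmem)
    have hnorm : ‖s‖ * ‖v‖ = ‖v‖ := by rw [← norm_smul, ← hs, LinearIsometryEquiv.norm_map]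
    have hs1 : |s| = 1 := by
      have : ‖v‖ ≠ 0 := norm_ne_zero_iff.2 hv0
      exact mul_right_cancel₀ this (by rw [one_mul]; exact hnorm)
    rcases eq_or_eq_neg_of_abs_eq hs1 with rfl | rfl
    · exact absurd (by rw [hs, one_smul]) hgv
    · rw [hs, neg_one_smul]
  have hgξ : g ξ = ξ := hξT g hg
  -- The isometry `g` fixes `ξ` and reverses `v`, so the inner product equals its own negative.
  have hvξ : inner ℝ v ξ = 0 := by
    have h1 : inner ℝ (g v) (g ξ) = inner ℝ v ξ := LinearIsometryEquiv.inner_map_map g v ξ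
    rw [hgv', hgξ, inner_neg_left] at h1
    linarith
  refine ⟨v, r, β, hξS, hξ0, hvP, hv0, hvξ, fun w hw => ?_, hr.symm, hAv, hβr,
    g, hT hg, hgξ, hgv'⟩
  obtain ⟨s, t, rfl⟩ := hspan w hw
  refine ⟨s - t * (α / (β - r)), t, ?_⟩
  rw [hv]
  module

/-- At a node, two pairs of an incoming and an outgoing plane have a plane in common. -/
theorem plane_eq_or_plane_eq {Γ : Subgroup O4} {f : E4 → E4} {ξ : E4}
    (hsep : (LinearMap.charpoly (fderiv ℝ f ξ : E4 →ₗ[ℝ] E4)).Separable)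
    {P Q P' Q' : Submodule ℝ E4} {p q p' q' : E4} {r a b r₂ r₃ r₄ a' b' : ℝ}
    (hP : IsFrame Γ f P ξ p r a) (hQ : IsFrame Γ f Q ξ q r₂ b)
    (hP' : IsFrame Γ f P' ξ p' r₃ a') (hQ' : IsFrame Γ f Q' ξ q' r₄ b')
    (hr : r < 0) (ha : a < 0) (ha' : a' < 0) (hb : 0 < b) (hb' : 0 < b') :
    P = P' ∨ Q = Q' := by
  have key : ∀ {R R' : Submodule ℝ E4} {u u' : E4} {s s' c : ℝ},
      IsFrame Γ f R ξ u s c → IsFrame Γ f R' ξ u' s' c → R = R' := by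
    intro R R' u u' s s' c hR hR'
    obtain ⟨k, hk⟩ := exists_smul_eq_of_mem_maxGenEigenspace hsep hR.dir_ne
      (mem_maxGenEigenspace_of_eigenvector hR.dir_eig)
      (mem_maxGenEigenspace_of_eigenvector hR'.dir_eig)
    exact hR.plane_eq hR' hk
  by_cases haa : a = a'
  · subst haa; exact Or.inl (key hP hP')
  by_cases hbb : b = b'
  · subst hbb; exact Or.inr (key hQ hQ')
  exfalso
  have hr3 : r₃ = r := by
    have := hP'.base_eig.symm.trans hP.base_eig
    exact smul_left_injective ℝ hP.base_ne this
  -- Among `r`, `a`, `a'`, `b`, `b'` the first three are negative and the last two positive; within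
  -- each sign distinctness is `eig_ne`, `haa` or `hbb`.
  have hinj : Function.Injective ![r, a, a', b, b'] := by
    have h1 := hP.eig_ne
    have h2 := hP'.eig_ne
    rw [hr3] at h2
    intro i j hij
    fin_cases i <;> fin_cases j <;> simp at hij ⊢ <;> first
      | exact absurd hij haa | exact absurd hij.symm haa | exact absurd hij hbb
      | exact absurd hij.symm hbb | exact absurd hij h1 | exact absurd hij.symm h1
      | exact absurd hij h2 | exact absurd hij.symm h2 | linarith
  have hli := Module.End.eigenvectors_linearIndependent' (fderiv ℝ f ξ : E4 →ₗ[ℝ] E4)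
    ![r, a, a', b, b'] hinj ![ξ, p, p', q, q'] (by
      intro i
      rw [Module.End.hasEigenvector_iff, Module.End.mem_eigenspace_iff]
      fin_cases i
      · exact ⟨hP.base_eig, hP.base_ne⟩
      · exact ⟨hP.dir_eig, hP.dir_ne⟩
      · exact ⟨hP'.dir_eig, hP'.dir_ne⟩
      · exact ⟨hQ.dir_eig, hQ.dir_ne⟩
      · exact ⟨hQ'.dir_eig, hQ'.dir_ne⟩)
  have := hli.fintype_card_le_finrank
  simp at this

/-! ### Connections with a common saddle. -/

/-- Near a saddle with orthonormal eigenvectors `e₁` (stable) and `e₂` (unstable) in an invariant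
plane, two backward asymptotic solutions in the plane with the same unstable coordinate agree. -/
theorem eq_of_unstable_coordinate_eq {f : E4 → E4} (hf : ContDiff ℝ 1 f) {P : Submodule ℝ E4}
    {a e₁ e₂ : E4} {r β : ℝ} (h1 : ‖e₁‖ = 1) (h2 : ‖e₂‖ = 1) (h12 : inner ℝ e₁ e₂ = 0)
    (hspan : ∀ w ∈ P, ∃ s t : ℝ, w = s • e₁ + t • e₂) (hA1 : fderiv ℝ f a e₁ = r • e₁)
    (hA2 : fderiv ℝ f a e₂ = β • e₂) (hr : r < 0) (hβ : 0 < β) :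
    ∃ U ∈ 𝓝 a, ∀ x y : ℝ → E4, (∀ t, HasDerivAt x (f (x t)) t) →
      (∀ t, HasDerivAt y (f (y t)) t) → (∀ t, x t ∈ P) → (∀ t, y t ∈ P) →
      Tendsto x atBot (𝓝 a) → Tendsto y atBot (𝓝 a) → ∀ T, (∀ t ≤ T, x t ∈ U ∧ y t ∈ U) →
      inner ℝ (x T) e₂ = inner ℝ (y T) e₂ → x T = y T := by
  -- The linear part contributes at most `-2 * m * ‖w‖ ^ 2` to the derivative of `D` below. A
  -- remainder with Lipschitz constant `m / 2` adds at most `m * ‖w‖ ^ 2` in each coordinate, so the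
  -- derivative stays nonpositive.
  set m := min (-r) β with hm
  have hm0 : 0 < m := lt_min (by linarith) hβ
  have hstrict : HasStrictFDerivAt f (fderiv ℝ f a) a :=
    (hf.contDiffAt (x := a)).hasStrictFDerivAt (by norm_num)
  obtain ⟨U, hU, happ⟩ := hstrict.approximates_deriv_on_nhds (c := (m / 2).toNNReal)
    (Or.inr (Real.toNNReal_pos.2 (half_pos hm0)))
  refine ⟨U, hU, fun x y hx hy hxP hyP hxa hya T hTU hT => ?_⟩
  have h21 : inner ℝ e₂ e₁ = 0 := by rw [real_inner_comm, h12]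
  have h11 : inner ℝ e₁ e₁ = 1 := by rw [real_inner_self_eq_norm_sq, h1, one_pow]
  have h22 : inner ℝ e₂ e₂ = 1 := by rw [real_inner_self_eq_norm_sq, h2, one_pow]
  have hdecomp : ∀ w ∈ P, w = (inner ℝ w e₁ : ℝ) • e₁ + (inner ℝ w e₂ : ℝ) • e₂ := by
    intro w hw
    obtain ⟨s, t, rfl⟩ := hspan w hw
    simp only [inner_add_left, inner_smul_left, conj_trivial, h11, h12, h21, h22]
    module
  let w : ℝ → E4 := fun t => x t - y t
  -- Cone function: it decreases up to time `T` and tends to `0` at `-∞`, so `D T ≤ 0`. If the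
  -- unstable coordinates agree at `T`, the stable ones must agree too.
  let D : ℝ → ℝ := fun t => (inner ℝ (w t) e₁) ^ 2 - (inner ℝ (w t) e₂) ^ 2
  have hwd : ∀ t, HasDerivAt w (f (x t) - f (y t)) t := fun t => (hx t).sub (hy t)
  have hcoord : ∀ e : E4, ∀ t, HasDerivAt (fun t => inner ℝ (w t) e)
      (inner ℝ (f (x t) - f (y t)) e) t := by
    intro e t
    simpa using (hwd t).inner ℝ (hasDerivAt_const t e)
  have hDd : ∀ t, HasDerivAt D (2 * inner ℝ (w t) e₁ * inner ℝ (f (x t) - f (y t)) e₁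
      - 2 * inner ℝ (w t) e₂ * inner ℝ (f (x t) - f (y t)) e₂) t := by
    intro t
    have := ((hcoord e₁ t).pow 2).sub ((hcoord e₂ t).pow 2)
    simp only [Nat.cast_ofNat, Nat.add_one_sub_one, pow_one] at this
    exact this
  have hDneg : ∀ t ≤ T, 2 * inner ℝ (w t) e₁ * inner ℝ (f (x t) - f (y t)) e₁
      - 2 * inner ℝ (w t) e₂ * inner ℝ (f (x t) - f (y t)) e₂ ≤ 0 := by
    intro t ht
    have hR := happ _ (hTU t ht).1 _ (hTU t ht).2
    set R := f (x t) - f (y t) - fderiv ℝ f a (x t - y t) with hRdef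
    have hw : w t = (inner ℝ (w t) e₁ : ℝ) • e₁ + (inner ℝ (w t) e₂ : ℝ) • e₂ :=
      hdecomp _ (P.sub_mem (hxP t) (hyP t))
    set X : ℝ := inner ℝ (w t) e₁ with hX
    set Y : ℝ := inner ℝ (w t) e₂ with hY
    have hfw : f (x t) - f (y t) = (r * X) • e₁ + (β * Y) • e₂ + R := by
      have : fderiv ℝ f a (x t - y t) = (r * X) • e₁ + (β * Y) • e₂ := by
        change fderiv ℝ f a (w t) = _
        rw [hw, map_add, map_smul, map_smul, hA1, hA2]
        module
      rw [hRdef, this]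
      abel
    have hn : ‖w t‖ ^ 2 = X ^ 2 + Y ^ 2 := by
      rw [← real_inner_self_eq_norm_sq]
      nth_rewrite 2 [hw]
      rw [inner_add_right, inner_smul_right, inner_smul_right]
      ring
    have hi1 : inner ℝ (f (x t) - f (y t)) e₁ = r * X + inner ℝ R e₁ := by
      rw [hfw]
      simp only [inner_add_left, inner_smul_left, conj_trivial, h11, h21]
      ring
    have hi2 : inner ℝ (f (x t) - f (y t)) e₂ = β * Y + inner ℝ R e₂ := by
      rw [hfw]
      simp only [inner_add_left, inner_smul_left, conj_trivial, h22, h12]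
      ring
    have hRn : ‖R‖ ≤ m / 2 * ‖w t‖ := by
      rwa [Real.coe_toNNReal _ (half_pos hm0).le] at hR
    have hb1 : |inner ℝ R e₁| ≤ m / 2 * ‖w t‖ := by
      have := abs_real_inner_le_norm R e₁
      rw [h1, mul_one] at this
      linarith
    have hb2 : |inner ℝ R e₂| ≤ m / 2 * ‖w t‖ := by
      have := abs_real_inner_le_norm R e₂
      rw [h2, mul_one] at this
      linarith
    have hX' : |X| ≤ ‖w t‖ := by
      have := abs_real_inner_le_norm (w t) e₁
      rwa [h1, mul_one] at this
    have hY' : |Y| ≤ ‖w t‖ := by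
      have := abs_real_inner_le_norm (w t) e₂
      rwa [h2, mul_one] at this
    have hp1 : X * inner ℝ R e₁ ≤ m / 2 * ‖w t‖ ^ 2 := by
      calc X * inner ℝ R e₁ ≤ |X * inner ℝ R e₁| := le_abs_self _
        _ = |X| * |inner ℝ R e₁| := abs_mul _ _
        _ ≤ ‖w t‖ * (m / 2 * ‖w t‖) := by gcongr
        _ = _ := by ring
    have hp2 : -(Y * inner ℝ R e₂) ≤ m / 2 * ‖w t‖ ^ 2 := by
      calc -(Y * inner ℝ R e₂) ≤ |Y * inner ℝ R e₂| := neg_le_abs _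
        _ = |Y| * |inner ℝ R e₂| := abs_mul _ _
        _ ≤ ‖w t‖ * (m / 2 * ‖w t‖) := by gcongr
        _ = _ := by ring
    have hm1 : m ≤ -r := min_le_left _ _
    have hm2 : m ≤ β := min_le_right _ _
    rw [hi1, hi2]
    have q1 : m * X ^ 2 ≤ -r * X ^ 2 := mul_le_mul_of_nonneg_right hm1 (sq_nonneg _)
    have q2 : m * Y ^ 2 ≤ β * Y ^ 2 := mul_le_mul_of_nonneg_right hm2 (sq_nonneg _)
    rw [hn] at hp1 hp2
    linarith
  have hanti : AntitoneOn D (Iic T) := by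
    refine antitoneOn_of_deriv_nonpos (convex_Iic T)
      (fun t _ => (hDd t).continuousAt.continuousWithinAt)
      (fun t _ => (hDd t).differentiableAt.differentiableWithinAt) fun t ht => ?_
    rw [(hDd t).deriv]
    exact hDneg t (mem_Iic.1 (interior_subset ht))
  have hDlim : Tendsto D atBot (𝓝 0) := by
    have hw0 : Tendsto w atBot (𝓝 0) := by simpa using hxa.sub hya
    have hc : Continuous fun z : E4 => (inner ℝ z e₁ : ℝ) ^ 2 - (inner ℝ z e₂ : ℝ) ^ 2 := by
      fun_prop
    have := (hc.tendsto 0).comp hw0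
    simp only [inner_zero_left, sub_self] at this
    exact this
  have hDT : D T ≤ 0 := by
    refine ge_of_tendsto hDlim ?_
    filter_upwards [eventually_le_atBot T] with t ht using hanti ht self_mem_Iic ht
  have hY0 : inner ℝ (w T) e₂ = 0 := by
    change inner ℝ (x T - y T) e₂ = 0
    rw [inner_sub_left, hT, sub_self]
  have hX0 : inner ℝ (w T) e₁ = 0 := by
    have hDT' : inner ℝ (w T) e₁ ^ 2 - inner ℝ (w T) e₂ ^ 2 ≤ 0 := hDT
    rw [hY0] at hDT'
    nlinarith
  have := hdecomp (w T) (P.sub_mem (hxP T) (hyP T))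
  rw [hX0, hY0, zero_smul, zero_smul, add_zero] at this
  exact sub_eq_zero.1 this

/-- A non-constant trajectory in the plane `P` from the saddle `a` to the sink `b`, both endpoints
carrying a frame of the plane. -/
structure IsLink (Γ : Subgroup O4) (f : E4 → E4) (P : Submodule ℝ E4) (a b : E4) (x : ℝ → E4) :
    Prop where
  equilibrium : f a = 0
  solution : ∀ t, HasDerivAt x (f (x t)) t
  nonconstant : ∃ t, x t ≠ a
  source : Tendsto x atBot (𝓝 a)
  target : Tendsto x atTop (𝓝 b)
  mem : ∀ t, x t ∈ P
  saddle : ∃ v r β, IsFrame Γ f P a v r β ∧ r < 0 ∧ 0 < β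
  sink : ∃ v r β, IsFrame Γ f P b v r β ∧ r < 0 ∧ β < 0

/-- A continuous function attains every positive value below `h T` before `T`, if it tends to zero
as `t → -∞`. -/
theorem exists_le_eq_of_tendsto_atBot {h : ℝ → ℝ} (hc : Continuous h) {T c : ℝ}
    (hlim : Tendsto h atBot (𝓝 0)) (hc0 : 0 < c) (hT : c ≤ h T) : ∃ s ≤ T, h s = c := by
  obtain ⟨s, hs, hsT⟩ := ((hlim.eventually (gt_mem_nhds hc0)).and (eventually_le_atBot T)).exists
  obtain ⟨u, hu, rfl⟩ := intermediate_value_Icc hsT hc.continuousOn ⟨hs.le, hT⟩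
  exact ⟨u, hu.2, rfl⟩

namespace IsLink

variable {Γ : Subgroup O4} {f : E4 → E4} {P : Submodule ℝ E4} {a b : E4} {x : ℝ → E4}

theorem continuous (X : IsLink Γ f P a b x) : Continuous x :=
  continuous_iff_continuousAt.2 fun t => (X.solution t).continuousAt

theorem map (X : IsLink Γ f P a b x) (hf : ContDiff ℝ 1 f) (h : IsEquivariant Γ f) {γ : O4}
    (hγ : γ ∈ Γ) :
    IsLink Γ f (P.map (γ.toLinearEquiv : E4 →ₗ[ℝ] E4)) (γ a) (γ b) (fun t => γ (x t)) where
  equilibrium := by rw [h γ hγ, X.equilibrium, map_zero]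
  solution := h.solution_comp hγ X.solution
  nonconstant := by
    obtain ⟨t, ht⟩ := X.nonconstant
    exact ⟨t, fun h => ht (γ.injective h)⟩
  source := (γ.continuous.tendsto a).comp X.source
  target := (γ.continuous.tendsto b).comp X.target
  mem t := ⟨x t, X.mem t, rfl⟩
  saddle := by
    obtain ⟨v, r, β, F, hr, hβ⟩ := X.saddle
    exact ⟨γ v, r, β, F.map hf h hγ, hr, hβ⟩
  sink := by
    obtain ⟨v, r, β, F, hr, hβ⟩ := X.sink
    exact ⟨γ v, r, β, F.map hf h hγ, hr, hβ⟩

end IsLink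

/-- The symmetry of a frame maps its plane to itself. -/
theorem IsFrame.map_flip_eq {Γ : Subgroup O4} {f : E4 → E4} {P : Submodule ℝ E4} {ξ v : E4}
    {r β : ℝ} (F : IsFrame Γ f P ξ v r β) {g : O4} (h1 : g ξ = ξ) (h2 : g v = -v) :
    P.map (g.toLinearEquiv : E4 →ₗ[ℝ] E4) = P := by
  ext w
  constructor
  · rintro ⟨z, hz, rfl⟩
    obtain ⟨s, t, rfl⟩ := F.spans z hz
    simp only [LinearEquiv.coe_coe, LinearIsometryEquiv.coe_toLinearEquiv, map_add, map_smul, h1,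
      h2]
    exact P.add_mem (P.smul_mem _ F.base_mem) (P.smul_mem _ (P.neg_mem F.dir_mem))
  · intro hw
    obtain ⟨s, t, rfl⟩ := F.spans w hw
    refine ⟨s • ξ - t • v, P.sub_mem (P.smul_mem _ F.base_mem) (P.smul_mem _ F.dir_mem), ?_⟩
    simp only [LinearEquiv.coe_coe, LinearIsometryEquiv.coe_toLinearEquiv, map_sub, map_smul, h1,
      h2]
    module

/-- Two trajectories in the same plane that emanate from the same saddle coincide up to
symmetry. -/
theorem IsLink.exists_image_eq_of_source_eq {Γ : Subgroup O4} {f : E4 → E4} (hf : ContDiff ℝ 1 f)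
    (h : IsEquivariant Γ f) {P : Submodule ℝ E4} {a b b' : E4} {x y : ℝ → E4}
    (X : IsLink Γ f P a b x) (Y : IsLink Γ f P a b' y) :
    ∃ γ ∈ Γ, (fun z => γ z) '' range x = range y := by
  obtain ⟨v, r, β, F, hr, hβ⟩ := X.saddle
  have hna : ‖a‖ ≠ 0 := norm_ne_zero_iff.2 F.base_ne
  have hnv : ‖v‖ ≠ 0 := norm_ne_zero_iff.2 F.dir_ne
  obtain ⟨U, hU, hcone⟩ := eq_of_unstable_coordinate_eq hf (P := P) (a := a)
    (e₁ := ‖a‖⁻¹ • a) (e₂ := ‖v‖⁻¹ • v) (r := r) (β := β)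
    (by rw [norm_smul, norm_inv, norm_norm, inv_mul_cancel₀ hna])
    (by rw [norm_smul, norm_inv, norm_norm, inv_mul_cancel₀ hnv])
    (by simp [inner_smul_left, inner_smul_right, F.inner_base_dir])
    (by
      intro w hw
      obtain ⟨s, t, rfl⟩ := F.spans w hw
      refine ⟨s * ‖a‖, t * ‖v‖, ?_⟩
      rw [smul_smul, smul_smul, mul_assoc, mul_assoc, mul_inv_cancel₀ hna, mul_inv_cancel₀ hnv,
        mul_one, mul_one])
    (by rw [map_smul, F.base_eig, smul_comm]) (by rw [map_smul, F.dir_eig, smul_comm]) hr hβ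
  have hev : ∀ {x : ℝ → E4} {b : E4}, IsLink Γ f P a b x → ∀ᶠ T in atBot, ∀ t ≤ T, x t ∈ U := by
    intro x b X
    obtain ⟨T, hT⟩ := eventually_atBot.1 (X.source.eventually hU)
    filter_upwards [eventually_le_atBot T] with s hs t ht using hT t (ht.trans hs)
  have hcont : ∀ {x : ℝ → E4} {b : E4}, IsLink Γ f P a b x →
      Continuous fun t => (inner ℝ (x t) v : ℝ) := fun X => X.continuous.inner continuous_const
  have hlim : ∀ {x : ℝ → E4} {b : E4}, IsLink Γ f P a b x →
      Tendsto (fun t => (inner ℝ (x t) v : ℝ)) atBot (𝓝 0) := by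
    intro x b X
    simpa [F.inner_base_dir] using X.source.inner (𝕜 := ℝ) (tendsto_const_nhds (x := v))
  -- the trajectory is eventually on one side of the line through the saddle
  have hside : ∀ {x : ℝ → E4} {b : E4}, IsLink Γ f P a b x →
      ∃ γ ∈ Γ, ∃ b', IsLink Γ f P a b' (fun t => γ (x t)) ∧
        ∀ᶠ T in atBot, 0 < (inner ℝ (γ (x T)) v : ℝ) := by
    intro x b X
    obtain ⟨T, hT⟩ := (hev X).exists
    -- A vanishing unstable coordinate would identify the trajectory with the constant solution `a`.
    have hne : ∀ t ≤ T, (inner ℝ (x t) v : ℝ) ≠ 0 := by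
      intro t ht h0
      have hxa : x t = a := hcone x (fun _ => a) X.solution
        (fun t => by rw [X.equilibrium]; exact hasDerivAt_const t a) X.mem (fun _ => F.base_mem)
        X.source tendsto_const_nhds t
        (fun s hs => ⟨hT s (hs.trans ht), mem_of_mem_nhds hU⟩)
        (by simp [inner_smul_right, h0, F.inner_base_dir])
      obtain ⟨s, hs⟩ := X.nonconstant
      exact hs ((solution_const_of_equilibrium hf X.solution
        (by rw [hxa, X.equilibrium]) s).trans hxa)
    rcases lt_or_gt_of_ne (hne T le_rfl) with hneg | hpos
    · obtain ⟨g, hg, hga, hgv⟩ := F.flip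
      refine ⟨g, hg, g b, ?_, ?_⟩
      · have := X.map hf h hg
        rwa [F.map_flip_eq hga hgv, hga] at this
      · filter_upwards [eventually_le_atBot T] with t ht
        have hflip : (inner ℝ (g (x t)) v : ℝ) = -inner ℝ (x t) v := by
          have := LinearIsometryEquiv.inner_map_map g (x t) v
          rw [hgv, inner_neg_right] at this
          linarith
        rw [hflip]
        by_contra! hcon
        obtain ⟨s, hs, hs0⟩ := intermediate_value_Icc' ht (hcont X).continuousOn
          (⟨hneg.le, by linarith⟩ : (0 : ℝ) ∈ Icc _ _)
        exact hne s hs.2 hs0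
    · refine ⟨1, Γ.one_mem, b, by simpa using X, ?_⟩
      filter_upwards [eventually_le_atBot T] with t ht
      by_contra! hcon
      obtain ⟨s, hs, hs0⟩ := intermediate_value_Icc ht (hcont X).continuousOn
        (⟨by simpa using hcon, hpos.le⟩ : (0 : ℝ) ∈ Icc _ _)
      exact hne s hs.2 hs0
  -- the two trajectories on the same side coincide
  have hrange : ∀ {x y : ℝ → E4} {b b' : E4}, IsLink Γ f P a b x → IsLink Γ f P a b' y →
      (∀ᶠ T in atBot, 0 < (inner ℝ (x T) v : ℝ)) → (∀ᶠ T in atBot, 0 < (inner ℝ (y T) v : ℝ)) →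
      range x = range y := by
    intro x y b b' X Y hx hy
    obtain ⟨T, ⟨hxU, hx0⟩, hyU, hy0⟩ := (((hev X).and hx).and ((hev Y).and hy)).exists
    have main : ∀ {x y : ℝ → E4} {b b' : E4}, IsLink Γ f P a b x → IsLink Γ f P a b' y →
        (∀ t ≤ T, x t ∈ U) → (∀ t ≤ T, y t ∈ U) → 0 < (inner ℝ (x T) v : ℝ) →
        (inner ℝ (x T) v : ℝ) ≤ inner ℝ (y T) v → range x = range y := by
      intro x y b b' X Y hxU hyU hx0 hle
      -- `y` has the unstable coordinate of `x T` at some `s ≤ T`. Shifting by `s - T ≤ 0` aligns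
      -- the two at time `T` and keeps the shifted `y` inside `U`.
      obtain ⟨s, hs, hsv⟩ := exists_le_eq_of_tendsto_atBot (hcont Y) (hlim Y) hx0 hle
      have heq : x T = y (T + (s - T)) := by
        refine hcone x (fun t => y (t + (s - T))) X.solution
          (fun t => (Y.solution _).comp_add_const _ _) X.mem (fun t => Y.mem _) X.source
          (Y.source.comp (tendsto_atBot_add_const_right _ _ tendsto_id)) T
          (fun t ht => ⟨hxU t ht, hyU _ (by linarith)⟩) ?_
        simp [inner_smul_right, hsv]
      have hshift := solution_shift_eq hf X.solution Y.solution heq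
      ext z
      constructor
      · rintro ⟨t, rfl⟩
        exact ⟨t - T + (T + (s - T)), by rw [← hshift]; congr 1; ring⟩
      · rintro ⟨t, rfl⟩
        exact ⟨t - (T + (s - T)) + T, by rw [hshift]; congr 1; ring⟩
    rcases le_total (inner ℝ (x T) v : ℝ) (inner ℝ (y T) v) with hle | hle
    · exact main X Y hxU hyU hx0 hle
    · exact (main Y X hyU hxU hy0 hle).symm
  obtain ⟨γ, hγ, c, X', hX'⟩ := hside X
  obtain ⟨δ, hδ, d, Y', hY'⟩ := hside Y
  have hr := hrange X' Y' hX' hY'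
  refine ⟨δ⁻¹ * γ, Γ.mul_mem (Γ.inv_mem hδ) hγ, ?_⟩
  have e1 : (fun z => (δ⁻¹ * γ) z) '' range x = (fun z => δ⁻¹ z) '' range fun t => γ (x t) := by
    rw [← range_comp, ← range_comp]; rfl
  rw [e1, hr, ← range_comp]
  congr 1
  ext1 t
  simp

/-! ### Connections with a common sink. -/

/-- A trajectory in the plane of a frame at `c` stays on one side of the invariant line through `c`,
unless its limit lies on that line. -/
theorem IsLink.inner_mul_inner_nonneg {Γ : Subgroup O4} {f : E4 → E4} (hf : ContDiff ℝ 1 f)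
    (h : IsEquivariant Γ f) {P : Submodule ℝ E4} {a b c v : E4} {r β : ℝ} {x : ℝ → E4}
    (X : IsLink Γ f P a b x) (F : IsFrame Γ f P c v r β) :
    0 ≤ (inner ℝ b v : ℝ) * inner ℝ a v := by
  by_cases hb : (inner ℝ b v : ℝ) = 0
  · rw [hb, zero_mul]
  have hcont : Continuous fun t => (inner ℝ (x t) v : ℝ) := X.continuous.inner continuous_const
  have htop : Tendsto (fun t => (inner ℝ (x t) v : ℝ)) atTop (𝓝 (inner ℝ b v)) :=
    X.target.inner tendsto_const_nhds
  have hbot : Tendsto (fun t => (inner ℝ (x t) v : ℝ)) atBot (𝓝 (inner ℝ a v)) :=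
    X.source.inner tendsto_const_nhds
  -- A point on the line through `c` is fixed by the flip, so by uniqueness the whole trajectory is,
  -- and its limit `b` lies on that line.
  have hne : ∀ t, (inner ℝ (x t) v : ℝ) ≠ 0 := by
    intro t ht
    obtain ⟨g, hg, hgc, hgv⟩ := F.flip
    obtain ⟨s, hs⟩ := F.base_of_inner_eq_zero (X.mem t) ht
    have hfix : ∀ τ, g (x τ) = x τ := solution_eq_of_eq_at hf (h.solution_comp hg X.solution)
      X.solution (t₀ := t) (by rw [hs, map_smul, hgc])
    have hzero : ∀ τ, (inner ℝ (x τ) v : ℝ) = 0 := by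
      intro τ
      have := LinearIsometryEquiv.inner_map_map g (x τ) v
      rw [hfix, hgv, inner_neg_right] at this
      linarith
    refine hb (tendsto_nhds_unique htop ?_)
    simp only [hzero]
    exact tendsto_const_nhds
  have hprod : ∀ t, 0 ≤ (inner ℝ b v : ℝ) * inner ℝ (x t) v := by
    intro t
    refine ge_of_tendsto (htop.mul_const (inner ℝ (x t) v)) (Eventually.of_forall fun s => ?_)
    by_contra! hcon
    have h0 : (0 : ℝ) ∈ uIcc (inner ℝ (x s) v) (inner ℝ (x t) v) := by
      rcases mul_neg_iff.1 hcon with ⟨h1, h2⟩ | ⟨h1, h2⟩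
      · exact mem_uIcc.2 (Or.inr ⟨h2.le, h1.le⟩)
      · exact mem_uIcc.2 (Or.inl ⟨h1.le, h2.le⟩)
    obtain ⟨τ, -, hτ⟩ := intermediate_value_uIcc (hcont.continuousOn (s := uIcc s t)) h0
    exact hne τ hτ
  exact ge_of_tendsto (hbot.const_mul _) (Eventually.of_forall hprod)

/-- In coordinates `p`, `q` with respect to a frame at the sink `b`: a trajectory from `a'` to `b`
does not cross the line through the saddle `a`. -/
theorem IsLink.cross_nonneg {Γ : Subgroup O4} {f : E4 → E4} (hf : ContDiff ℝ 1 f)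
    (h : IsEquivariant Γ f) {P : Submodule ℝ E4} {a a' b n : E4} {r β p q p' q' : ℝ} {x y : ℝ → E4}
    (X : IsLink Γ f P a b x) (Y : IsLink Γ f P a' b y) (F : IsFrame Γ f P b n r β)
    (ha : a = p • b + q • n) (ha' : a' = p' • b + q' • n) (hq : 0 < q) :
    0 ≤ p' * q - q' * p := by
  obtain ⟨v, s, η, G, -, -⟩ := X.saddle
  -- `a'` and `b` lie on the same side of the line through `a`. The sign of `p' * q - q' * p` tells
  -- this side, since it equals `q > 0` for `b` itself.
  have hnn := Y.inner_mul_inner_nonneg hf h G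
  obtain ⟨α, ω, hv⟩ := F.spans v G.dir_mem
  have horth := G.orth
  have hbb : 0 < (inner ℝ b b : ℝ) := real_inner_self_pos.2 F.base_ne
  have hnn' : 0 < (inner ℝ n n : ℝ) := real_inner_self_pos.2 F.dir_ne
  rw [ha, hv] at horth
  rw [ha', hv] at hnn
  simp only [inner_add_left, inner_add_right, inner_smul_left, inner_smul_right, conj_trivial,
    F.orth, F.inner_base_dir, mul_zero, add_zero, zero_add] at horth hnn
  have hα : α ≠ 0 := by
    rintro rfl
    have hω : ω = 0 := by
      have : ω * (q * inner ℝ n n) = 0 := by linarith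
      exact (mul_eq_zero.1 this).resolve_right (by positivity)
    exact G.dir_ne (by rw [hv, hω]; simp)
  -- Orthogonality of `v` and `a` eliminates `ω` after multiplication by `q`.
  have hkey : 0 ≤ (α * inner ℝ b b) ^ 2 * (p' * q - q' * p) := by
    have := mul_nonneg hnn hq.le
    refine this.trans_eq ?_
    linear_combination (α * inner ℝ b b * q') * horth
  exact nonneg_of_mul_nonneg_right hkey (by positivity)

/-- A saddle has a positive eigenvalue in the plane, a sink does not. -/
theorem IsLink.source_ne_target {Γ : Subgroup O4} {f : E4 → E4} {P : Submodule ℝ E4} {a b : E4}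
    {x : ℝ → E4} (X : IsLink Γ f P a b x) : a ≠ b := by
  rintro rfl
  obtain ⟨v, r, β, F, hr, hβ⟩ := X.saddle
  obtain ⟨v', r', β', G, hr', hβ'⟩ := X.sink
  rcases G.re_eq_of_isEigenvalueOn F.isEigenvalueOn_dir with h | h <;>
    · rw [Complex.ofReal_re] at h
      linarith

/-- Two trajectories in the same plane to the same sink coincide up to symmetry, if the saddles
and the sink are subject to the condition that rays contain at most one of them, up to symmetry. -/
theorem IsLink.exists_image_eq_of_target_eq {Γ : Subgroup O4} {f : E4 → E4} (hf : ContDiff ℝ 1 f)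
    (h : IsEquivariant Γ f) {P : Submodule ℝ E4} {a a' b : E4} {x y : ℝ → E4}
    (X : IsLink Γ f P a b x) (Y : IsLink Γ f P a' b y)
    (hab : ∀ γ ∈ Γ, ∀ s : ℝ, 0 < s → γ a = s • b → γ a = b)
    (hab' : ∀ γ ∈ Γ, ∀ s : ℝ, 0 < s → γ a' = s • b → γ a' = b)
    (haa : ∀ γ ∈ Γ, ∀ δ ∈ Γ, ∀ s : ℝ, 0 < s → γ a = s • δ a' → γ a = δ a') :
    ∃ γ ∈ Γ, (fun z => γ z) '' range x = range y := by
  obtain ⟨n, r, β, F, -, -⟩ := X.sink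
  have hbb : 0 < (inner ℝ b b : ℝ) := real_inner_self_pos.2 F.base_ne
  have hnn : 0 < (inner ℝ n n : ℝ) := real_inner_self_pos.2 F.dir_ne
  -- The flip at the sink moves any saddle into the closed half-plane `q ≥ 0`.
  have hupper : ∀ {a : E4} {x : ℝ → E4}, IsLink Γ f P a b x → ∃ γ ∈ Γ,
      IsLink Γ f P (γ a) b (fun t => γ (x t)) ∧ ∃ p q : ℝ, 0 ≤ q ∧ γ a = p • b + q • n := by
    intro a x X
    obtain ⟨v, s, η, G, -, -⟩ := X.saddle
    obtain ⟨p, q, hpq⟩ := F.spans a G.base_mem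
    rcases le_total 0 q with hq | hq
    · exact ⟨1, Γ.one_mem, by simpa using X, p, q, hq, by simpa using hpq⟩
    · obtain ⟨g, hg, hgb, hgn⟩ := F.flip
      refine ⟨g, hg, ?_, p, -q, by linarith, ?_⟩
      · have := X.map hf h hg
        rwa [F.map_flip_eq hgb hgn, hgb] at this
      · rw [hpq, map_add, map_smul, map_smul, hgb, hgn, smul_neg, neg_smul]
  obtain ⟨γ, hγ, X', p, q, hq, ha⟩ := hupper X
  obtain ⟨δ, hδ, Y', p', q', hq', ha'⟩ := hupper Y
  -- A saddle on the line through `b` is on the far side, since on the ray of `b` it would equal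
  -- `b`.
  have hp : q = 0 → p < 0 := by
    rintro rfl
    obtain ⟨v, s, η, G, -, -⟩ := X'.saddle
    rcases lt_trichotomy p 0 with hlt | rfl | hgt
    · exact hlt
    · exact absurd (by rw [ha]; simp) G.base_ne
    · exact absurd (hab γ hγ p hgt (by rw [ha]; simp)) X'.source_ne_target
  have hp' : q' = 0 → p' < 0 := by
    rintro rfl
    obtain ⟨v, s, η, G, -, -⟩ := Y'.saddle
    rcases lt_trichotomy p' 0 with hlt | rfl | hgt
    · exact hlt
    · exact absurd (by rw [ha']; simp) G.base_ne
    · exact absurd (hab' δ hδ p' hgt (by rw [ha']; simp)) Y'.source_ne_target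
  -- The two barrier inequalities are opposite and yield `p * q' = p' * q`. If just one saddle lies
  -- on the boundary line, the remaining inequality contradicts its negative coordinate.
  have hray : ∃ s : ℝ, 0 < s ∧ γ a = s • δ a' := by
    rcases hq.eq_or_lt with h0 | hq
    · rcases hq'.eq_or_lt with h0' | hq'
      · refine ⟨p / p', div_pos_of_neg_of_neg (hp h0.symm) (hp' h0'.symm), ?_⟩
        rw [ha, ha', ← h0, ← h0', zero_smul, add_zero, add_zero, smul_smul,
          div_mul_cancel₀ _ (hp' h0'.symm).ne]
      · have := Y'.cross_nonneg hf h X' F ha' ha hq'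
        have := hp h0.symm
        rw [← h0] at *
        nlinarith
    · rcases hq'.eq_or_lt with h0' | hq'
      · have := X'.cross_nonneg hf h Y' F ha ha' hq
        have := hp' h0'.symm
        rw [← h0'] at *
        nlinarith
      · have h1 := X'.cross_nonneg hf h Y' F ha ha' hq
        have h2 := Y'.cross_nonneg hf h X' F ha' ha hq'
        have h3 : p * q' = p' * q := by linarith
        refine ⟨q / q', div_pos hq hq', ?_⟩
        rw [ha, ha', smul_add, smul_smul, smul_smul, div_mul_cancel₀ _ hq'.ne']
        congr 2
        field_simp
        linarith
  obtain ⟨s, hs, hsa⟩ := hray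
  rw [haa γ hγ δ hδ s hs hsa] at X'
  obtain ⟨ε, hε, hr⟩ := X'.exists_image_eq_of_source_eq hf h Y'
  refine ⟨δ⁻¹ * ε * γ, Γ.mul_mem (Γ.mul_mem (Γ.inv_mem hδ) hε) hγ, ?_⟩
  have e1 : (fun z => (δ⁻¹ * ε * γ) z) '' range x
      = (fun z => δ⁻¹ z) '' ((fun z => ε z) '' range fun t => γ (x t)) := by
    rw [← range_comp, ← range_comp, ← range_comp]; rfl
  rw [e1, hr, ← range_comp]
  congr 1
  ext1 t
  simp

/-! ### Planes, lines and frames of a simple cycle. -/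

theorem IsIsotropySubgroup.le {Γ S : Subgroup O4} (h : IsIsotropySubgroup Γ S) : S ≤ Γ := by
  obtain ⟨x, hx⟩ := h
  exact fun γ hγ => ((hx γ).1 hγ).1

namespace SimpleCycle

variable {Γ : Subgroup O4} {f : E4 → E4}

theorem node_mem_plane (X : SimpleCycle Γ f) (i : ZMod X.len) : X.node i ∈ X.plane i :=
  (X.plane i).closed_of_finiteDimensional.mem_of_tendsto (X.from_node i)
    (Eventually.of_forall (X.traj_mem i))

theorem node_succ_mem_plane (X : SimpleCycle Γ f) (i : ZMod X.len) :
    X.node (i + 1) ∈ X.plane i :=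
  (X.plane i).closed_of_finiteDimensional.mem_of_tendsto (X.to_node i)
    (Eventually.of_forall (X.traj_mem i))

theorem node_mem_plane_pred (X : SimpleCycle Γ f) (i : ZMod X.len) :
    X.node i ∈ X.plane (i - 1) := by
  simpa using X.node_succ_mem_plane (i - 1)

theorem node_mem_carrier (X : SimpleCycle Γ f) (i : ZMod X.len) : X.node i ∈ X.carrier :=
  Or.inl (mem_range_self i)

theorem node_ne_zero (X : SimpleCycle Γ f) (i : ZMod X.len) : X.node i ≠ 0 :=
  fun h => X.zero_notMem (h ▸ X.node_mem_carrier i)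

theorem sink_pred (X : SimpleCycle Γ f) (i : ZMod X.len) :
    IsSinkIn f (X.plane (i - 1)) (X.node i) := by
  simpa [plane] using X.sink (i - 1)

/-- The node is a sink in one plane and a saddle in the other. -/
theorem plane_pred_ne (X : SimpleCycle Γ f) (i : ZMod X.len) : X.plane (i - 1) ≠ X.plane i := by
  intro h
  obtain ⟨-, ⟨μ, hμ, hpos⟩, -⟩ := X.saddle i
  have := X.sink_pred i
  rw [h] at this
  exact absurd (this μ hμ) (not_lt.2 hpos.le)

/-- The line `L_i` is spanned by the node `ξ_i`. -/
theorem line_eq_span (X : SimpleCycle Γ f) (i : ZMod X.len) :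
    X.plane (i - 1) ⊓ X.plane i = Submodule.span ℝ {X.node i} := by
  symm
  refine Submodule.eq_of_le_of_finrank_le ?_ ?_
  · simpa using ⟨X.node_mem_plane_pred i, X.node_mem_plane i⟩
  · rw [finrank_span_singleton (X.node_ne_zero i)]
    have h1 : Module.finrank ℝ (X.plane (i - 1)) = 2 := X.finrank_plane _
    have h2 : Module.finrank ℝ (X.plane i) = 2 := X.finrank_plane _
    have hlt : X.plane (i - 1) ⊓ X.plane i < X.plane (i - 1) := by
      refine lt_of_le_of_ne inf_le_left fun h => X.plane_pred_ne i ?_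
      exact Submodule.eq_of_le_of_finrank_le (inf_eq_left.1 h) (by omega)
    have := Submodule.finrank_lt_finrank_of_lt hlt
    omega

theorem exists_isFrame_in (X : SimpleCycle Γ f) (hf : ContDiff ℝ 1 f) (h : IsEquivariant Γ f)
    (i : ZMod X.len) :
    ∃ v r β, IsFrame Γ f (X.plane (i - 1)) (X.node i) v r β ∧ r < 0 ∧ β < 0 := by
  obtain ⟨v, r, β, F⟩ := exists_isFrame hf h (X.iso_isotropy (i - 1)).le (X.iso_isotropy i).le
    (X.node_ne_zero i) (X.finrank_plane _) (X.line_eq_span i) (X.no_double_eigenvalue i)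
  exact ⟨v, r, β, F, X.sink_pred i r F.isEigenvalueOn_base, X.sink_pred i β F.isEigenvalueOn_dir⟩

/-- The eigenvalue along the node is negative, as seen in the incoming plane, so the positive
eigenvalue of the saddle has to be `β`. -/
theorem exists_isFrame_out (X : SimpleCycle Γ f) (hf : ContDiff ℝ 1 f) (h : IsEquivariant Γ f)
    (i : ZMod X.len) :
    ∃ v r β, IsFrame Γ f (X.plane i) (X.node i) v r β ∧ r < 0 ∧ 0 < β := by
  obtain ⟨v, r, β, F⟩ := exists_isFrame hf h (X.iso_isotropy i).le (X.iso_isotropy (i - 1)).le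
    (X.node_ne_zero i) (X.finrank_plane _) ((inf_comm _ _).trans (X.line_eq_span i))
    (X.no_double_eigenvalue i)
  obtain ⟨v', r', β', F', hr', -⟩ := X.exists_isFrame_in hf h i
  have hr : r < 0 := by
    have : r • X.node i = r' • X.node i := F.base_eig.symm.trans F'.base_eig
    rwa [smul_left_injective ℝ F.base_ne this]
  obtain ⟨-, ⟨μ, hμ, hpos⟩, -⟩ := X.saddle i
  refine ⟨v, r, β, F, hr, ?_⟩
  rcases F.re_eq_of_isEigenvalueOn hμ with h | h <;> linarith

theorem isLink (X : SimpleCycle Γ f) (hf : ContDiff ℝ 1 f) (h : IsEquivariant Γ f)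
    (i : ZMod X.len) :
    IsLink Γ f (X.plane i) (X.node i) (X.node (i + 1)) (X.traj i) where
  equilibrium := X.equilibrium i
  solution := X.solution i
  nonconstant := X.nonconstant i
  source := X.from_node i
  target := X.to_node i
  mem := X.traj_mem i
  saddle := X.exists_isFrame_out hf h i
  sink := by simpa using X.exists_isFrame_in hf h (i + 1)

theorem isLink_pred (X : SimpleCycle Γ f) (hf : ContDiff ℝ 1 f) (h : IsEquivariant Γ f)
    (i : ZMod X.len) :
    IsLink Γ f (X.plane (i - 1)) (X.node (i - 1)) (X.node i) (X.traj (i - 1)) := by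
  simpa using X.isLink hf h (i - 1)

end SimpleCycle

/-! ### From a common node to a common connection. -/

/-- An open ray is connected, so it lies within one component of `L \ {0}`. -/
theorem MeetsComponentsAtMostOnce.eq_of_smul {S : Set E4} {L : Submodule ℝ E4}
    (h : MeetsComponentsAtMostOnce S L) {x : E4} (hxL : x ∈ L) (hx0 : x ≠ 0) (hx : x ∈ S) {s : ℝ}
    (hs : 0 < s) (hsx : s • x ∈ S) : s • x = x := by
  have hmem : ∀ t ∈ Ioi (0 : ℝ), t • x ∈ (L : Set E4) \ {0} := fun t ht =>
    ⟨L.smul_mem _ hxL, smul_ne_zero (ne_of_gt ht) hx0⟩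
  have hsub : (fun t : ℝ => t • x) '' Ioi 0 ⊆ connectedComponentIn ((L : Set E4) \ {0}) x := by
    refine IsPreconnected.subset_connectedComponentIn ?_ ⟨1, by simp, by simp⟩ ?_
    · exact isPreconnected_Ioi.image _ (by fun_prop)
    · rintro _ ⟨t, ht, rfl⟩
      exact hmem t ht
  exact h x ⟨hxL, hx0⟩ ⟨hsub ⟨s, hs, rfl⟩, hsx⟩ ⟨hsub ⟨1, by simp, by simp⟩, hx⟩

namespace SimpleNetwork

variable {Γ : Subgroup O4} {f : E4 → E4}

theorem apply_node_mem_orbitSet (N : SimpleNetwork Γ f) {γ : O4} (hγ : γ ∈ Γ) (c : Fin N.card)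
    (i : ZMod (N.cycle c).len) :
    γ ((N.cycle c).node i) ∈ orbitSet Γ (⋃ d, (N.cycle d).carrier) :=
  ⟨γ, hγ, _, mem_iUnion.2 ⟨c, (N.cycle c).node_mem_carrier i⟩, rfl⟩

/-- Images of nodes on a common ray coincide. -/
theorem apply_node_eq_of_ray (N : SimpleNetwork Γ f) {γ δ : O4} (hγ : γ ∈ Γ) (hδ : δ ∈ Γ)
    {c d : Fin N.card} {i : ZMod (N.cycle c).len} {j : ZMod (N.cycle d).len} {s : ℝ} (hs : 0 < s)
    (h : γ ((N.cycle c).node i) = s • δ ((N.cycle d).node j)) :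
    γ ((N.cycle c).node i) = δ ((N.cycle d).node j) := by
  have h' : (δ⁻¹ * γ) ((N.cycle c).node i) = s • (N.cycle d).node j := by
    have := congrArg (fun z => δ⁻¹ z) h
    simpa using this
  have hmem := N.apply_node_mem_orbitSet (Γ.mul_mem (Γ.inv_mem hδ) hγ) c i
  have hmem' := N.apply_node_mem_orbitSet Γ.one_mem d j
  rw [h'] at hmem
  have := (N.meets_line d j).eq_of_smul
    ⟨(N.cycle d).node_mem_plane_pred j, (N.cycle d).node_mem_plane j⟩
    ((N.cycle d).node_ne_zero j) hmem' hs hmem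
  rw [h, ← map_smul, this]

/-- Two cycles of a network that have a node in common up to symmetry have a connecting trajectory
in common up to symmetry. -/
theorem haveCommonConnection_of_node (N : SimpleNetwork Γ f) (hf : ContDiff ℝ 1 f)
    (h : IsEquivariant Γ f) {c d : Fin N.card} {i : ZMod (N.cycle c).len}
    {j : ZMod (N.cycle d).len} {γ : O4} (hγ : γ ∈ Γ)
    (hij : γ ((N.cycle c).node i) = (N.cycle d).node j) :
    HaveCommonConnection (N.cycle c).toHeteroclinicCycle (N.cycle d).toHeteroclinicCycle := by
  have Xout := ((N.cycle c).isLink hf h i).map hf h hγ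
  have Xin := ((N.cycle c).isLink_pred hf h i).map hf h hγ
  have Yout := (N.cycle d).isLink hf h j
  have Yin := (N.cycle d).isLink_pred hf h j
  rw [hij] at Xout Xin
  have hcomp : ∀ {x : ℝ → E4} {δ : O4}, (fun z => (δ * γ) z) '' range x
      = (fun z => δ z) '' range fun t => γ (x t) := by
    intro x δ
    rw [← range_comp, ← range_comp]; rfl
  obtain ⟨q, r₂, b, F₂, -, hb⟩ := Xout.saddle
  obtain ⟨p, r, a, F, hr, ha⟩ := Xin.sink
  obtain ⟨q', r₄, b', F₄, -, hb'⟩ := Yout.saddle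
  obtain ⟨p', r₃, a', F₃, -, ha'⟩ := Yin.sink
  -- A common incoming plane gives the connections into the node, a common outgoing plane those out
  -- of it. The ray conditions of the first case hold for all nodes of the network.
  rcases plane_eq_or_plane_eq ((N.cycle d).no_double_eigenvalue j) F F₂ F₃ F₄ hr ha ha' hb hb' with
    hP | hQ
  · rw [hP] at Xin
    obtain ⟨δ, hδ, hr⟩ := Xin.exists_image_eq_of_target_eq hf h Yin
      (fun ε hε s hs hsb =>
        N.apply_node_eq_of_ray (δ := 1) (Γ.mul_mem hε hγ) Γ.one_mem hs hsb)
      (fun ε hε s hs hsb => N.apply_node_eq_of_ray (δ := 1) hε Γ.one_mem hs hsb)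
      (fun ε hε δ hδ s hs hsb => N.apply_node_eq_of_ray (Γ.mul_mem hε hγ) hδ hs hsb)
    exact ⟨i - 1, j - 1, δ * γ, Γ.mul_mem hδ hγ, hcomp.trans hr⟩
  · rw [hQ] at Xout
    obtain ⟨δ, hδ, hr⟩ := Xout.exists_image_eq_of_source_eq hf h Yout
    exact ⟨i, j, δ * γ, Γ.mul_mem hδ hγ, hcomp.trans hr⟩

end SimpleNetwork

/-! ### Connectedness of the network. -/

/-- The orbit of a continuous curve with limits at both ends is compact together with the limits. -/
theorem isCompact_insert_insert_range {x : ℝ → E4} {a b : E4} (hx : Continuous x)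
    (ha : Tendsto x atBot (𝓝 a)) (hb : Tendsto x atTop (𝓝 b)) :
    IsCompact (insert a (insert b (range x))) := by
  -- Composing with `|t|` and `-|t|` splits the curve into halves, each with a single limit along
  -- `cocompact ℝ`.
  have habs : Tendsto (fun t : ℝ => |t|) (cocompact ℝ) atTop := tendsto_norm_cocompact_atTop
  have h1 : IsCompact (insert b (range fun t : ℝ => x |t|)) :=
    (hb.comp habs).isCompact_insert_range_of_cocompact (hx.comp continuous_abs)
  have h2 : IsCompact (insert a (range fun t : ℝ => x (-|t|))) :=
    (ha.comp (tendsto_neg_atTop_atBot.comp habs)).isCompact_insert_range_of_cocompact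
      (hx.comp continuous_abs.neg)
  convert h1.union h2 using 1
  ext z
  simp only [mem_insert_iff, mem_range, mem_union]
  constructor
  · rintro (rfl | rfl | ⟨t, rfl⟩)
    · tauto
    · tauto
    · rcases le_total 0 t with ht | ht
      · exact Or.inl (Or.inr ⟨t, by rw [abs_of_nonneg ht]⟩)
      · exact Or.inr (Or.inr ⟨t, by rw [abs_of_nonpos ht, neg_neg]⟩)
  · rintro ((rfl | ⟨t, rfl⟩) | (rfl | ⟨t, rfl⟩))
    · tauto
    · exact Or.inr (Or.inr ⟨_, rfl⟩)
    · tauto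
    · exact Or.inr (Or.inr ⟨_, rfl⟩)

namespace HeteroclinicCycle

variable {Γ : Subgroup O4} {f : E4 → E4}

theorem isClosed_carrier (X : HeteroclinicCycle Γ f) : IsClosed X.carrier := by
  have : NeZero X.len := ⟨X.len_pos.ne'⟩
  have hcar : X.carrier = ⋃ i, insert (X.node i) (insert (X.node (i + 1)) (range (X.traj i))) := by
    ext z
    simp only [carrier, connection, mem_union, mem_range, mem_iUnion, mem_insert_iff]
    constructor
    · rintro (⟨i, rfl⟩ | ⟨i, t, rfl⟩)
      · exact ⟨i, Or.inl rfl⟩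
      · exact ⟨i, Or.inr (Or.inr ⟨t, rfl⟩)⟩
    · rintro ⟨i, rfl | rfl | ⟨t, rfl⟩⟩
      · exact Or.inl ⟨i, rfl⟩
      · exact Or.inl ⟨i + 1, rfl⟩
      · exact Or.inr ⟨i, t, rfl⟩
  rw [hcar]
  refine isClosed_iUnion_of_finite fun i => (isCompact_insert_insert_range
    (continuous_iff_continuousAt.2 fun t => (X.solution i t).continuousAt)
    (X.from_node i) (X.to_node i)).isClosed

/-- No connecting trajectory passes through an equilibrium. -/
theorem traj_ne_of_equilibrium (X : HeteroclinicCycle Γ f) (hf : ContDiff ℝ 1 f) {z : E4}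
    (hz : f z = 0) (i : ZMod X.len) (t : ℝ) : X.traj i t ≠ z := by
  rintro rfl
  have hconst := solution_const_of_equilibrium hf (X.solution i) hz
  have hlim : X.node i = X.traj i t := by
    refine tendsto_nhds_unique (X.from_node i) ?_
    rw [funext hconst]
    exact tendsto_const_nhds
  obtain ⟨s, hs⟩ := X.nonconstant i
  exact hs ((hconst s).trans hlim.symm)

/-- Two cycles that meet have a common node. -/
theorem exists_node_eq_of_carrier_inter (X Y : HeteroclinicCycle Γ f) (hf : ContDiff ℝ 1 f)
    {z : E4} (hX : z ∈ X.carrier) (hY : z ∈ Y.carrier) : ∃ i j, X.node i = Y.node j := by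
  simp only [carrier, connection, mem_union, mem_range, mem_iUnion] at hX hY
  rcases hX with ⟨i, rfl⟩ | ⟨i, s, rfl⟩ <;> rcases hY with ⟨j, hj⟩ | ⟨j, t, hj⟩
  · exact ⟨i, j, hj.symm⟩
  · exact absurd hj (Y.traj_ne_of_equilibrium hf (X.equilibrium i) j t)
  · exact absurd hj.symm (X.traj_ne_of_equilibrium hf (Y.equilibrium j) i s)
  -- Meeting trajectories are time shifts of each other and have the same limit at `-∞`.
  · refine ⟨i, j, ?_⟩
    have hshift := solution_shift_eq hf (X.solution i) (Y.solution j) hj.symm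
    have h1 : Tendsto (fun τ => X.traj i (τ + s)) atBot (𝓝 (X.node i)) :=
      (X.from_node i).comp (tendsto_atBot_add_const_right _ _ tendsto_id)
    have h2 : Tendsto (fun τ => Y.traj j (τ + t)) atBot (𝓝 (Y.node j)) :=
      (Y.from_node j).comp (tendsto_atBot_add_const_right _ _ tendsto_id)
    rw [funext hshift] at h1
    exact tendsto_nhds_unique h1 h2

end HeteroclinicCycle

/-- A property that two cycles with a common node share holds for all cycles of a network if it
holds for one of them. -/
theorem SimpleNetwork.forall_of_exists {Γ : Subgroup O4} {f : E4 → E4} (N : SimpleNetwork Γ f)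
    (hf : ContDiff ℝ 1 f) {p : Fin N.card → Prop} {c : Fin N.card} (hc : p c)
    (hp : ∀ d e, p d → ∀ i j, (N.cycle d).node i = (N.cycle e).node j → p e) (d : Fin N.card) :
    p d := by
  -- The cycles with `p` and those without form two closed sets covering the network; they are
  -- disjoint because cycles that meet share a node.
  have hclosed : ∀ q : Fin N.card → Prop, IsClosed (⋃ e, ⋃ (_ : q e), (N.cycle e).carrier) :=
    fun q => isClosed_iUnion_of_finite fun e => isClosed_iUnion_of_finite fun _ =>
      (N.cycle e).isClosed_carrier
  have hsep : ∀ {d e z}, p d → ¬ p e → z ∈ (N.cycle d).carrier → z ∉ (N.cycle e).carrier := by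
    intro d e z hd he hzd hze
    obtain ⟨i, j, hij⟩ := (N.cycle d).exists_node_eq_of_carrier_inter
      (N.cycle e).toHeteroclinicCycle hf hzd hze
    exact he (hp d e hd i j hij)
  by_contra hd
  rcases isPreconnected_iff_subset_of_disjoint_closed.1 N.connected.isPreconnected _ _
    (hclosed p) (hclosed fun e => ¬ p e) (by
      intro z hz
      obtain ⟨e, he⟩ := mem_iUnion.1 hz
      by_cases hpe : p e
      · exact Or.inl (mem_iUnion₂.2 ⟨e, hpe, he⟩)
      · exact Or.inr (mem_iUnion₂.2 ⟨e, hpe, he⟩)) (by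
      rw [eq_empty_iff_forall_notMem]
      rintro z ⟨-, h1, h2⟩
      obtain ⟨e, he, hze⟩ := mem_iUnion₂.1 h1
      obtain ⟨e', he', hze'⟩ := mem_iUnion₂.1 h2
      exact hsep he he' hze hze') with hsub | hsub
  · have hz := (N.cycle d).node_mem_carrier 0
    obtain ⟨e, he, hze⟩ := mem_iUnion₂.1 (hsub (mem_iUnion.2 ⟨d, hz⟩))
    exact hsep he hd hze hz
  · have hz := (N.cycle c).node_mem_carrier 0
    obtain ⟨e, he, hze⟩ := mem_iUnion₂.1 (hsub (mem_iUnion.2 ⟨c, hz⟩))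
    exact hsep hc he hz hze

/-! ### Nodes on coordinate axes and the existence of a common node. -/

/-- Two points on coordinate axes are orthogonal or proportional. -/
theorem inner_eq_zero_or_exists_smul {x y : E4} (hx : OnCoordinateAxis x)
    (hy : OnCoordinateAxis y) (hx0 : x ≠ 0) : inner ℝ x y = 0 ∨ ∃ s : ℝ, y = s • x := by
  obtain ⟨k, hk⟩ := hx
  obtain ⟨l, hl⟩ := hy
  by_cases hkl : l = k
  · subst hkl
    right
    have hxl : x l ≠ 0 := by
      intro h0
      refine hx0 (PiLp.ext fun m => ?_)
      by_cases hm : m = l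
      · rw [hm, h0]; rfl
      · rw [hk m hm]; rfl
    refine ⟨y l / x l, PiLp.ext fun m => ?_⟩
    by_cases hm : m = l
    · rw [hm, PiLp.smul_apply, smul_eq_mul, div_mul_cancel₀ _ hxl]
    · rw [PiLp.smul_apply, hk m hm, hl m hm, smul_zero]
  · left
    rw [PiLp.inner_apply]
    refine Finset.sum_eq_zero fun m _ => ?_
    by_cases hm : m = k
    · rw [hl m (by rw [hm]; exact fun h => hkl h.symm), inner_zero_right]
    · rw [hk m hm, inner_zero_left]

/-- Some symmetry maps `z` to `-z`. -/
def IsReversible (Γ : Subgroup O4) (z : E4) : Prop :=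
  ∃ γ ∈ Γ, γ z = -z

theorem IsReversible.smul {Γ : Subgroup O4} {z : E4} (h : IsReversible Γ z) (s : ℝ) :
    IsReversible Γ (s • z) := by
  obtain ⟨γ, hγ, hz⟩ := h
  exact ⟨γ, hγ, by rw [map_smul, hz, smul_neg]⟩

/-- Such a `w` is a multiple of `v`, which the flip negates. -/
theorem IsFrame.isReversible {Γ : Subgroup O4} {f : E4 → E4} {P : Submodule ℝ E4} {ξ v w : E4}
    {r β : ℝ} (F : IsFrame Γ f P ξ v r β) (hw : w ∈ P) (h : inner ℝ w ξ = 0) :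
    IsReversible Γ w := by
  obtain ⟨t, rfl⟩ := F.dir_of_inner_eq_zero hw h
  obtain ⟨g, hg, -, hgv⟩ := F.flip
  exact IsReversible.smul ⟨g, hg, hgv⟩ t

namespace SimpleNetwork

variable {Γ : Subgroup O4} {f : E4 → E4}

/-- Consecutive nodes on coordinate axes are both reversible, or lie on opposite sides of the same
axis. -/
theorem isReversible_or_opposite (N : SimpleNetwork Γ f) (hf : ContDiff ℝ 1 f)
    (h : IsEquivariant Γ f) (hN : ∀ c i, OnCoordinateAxis ((N.cycle c).node i)) (c : Fin N.card)
    (i : ZMod (N.cycle c).len) :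
    (IsReversible Γ ((N.cycle c).node i) ∧ IsReversible Γ ((N.cycle c).node (i + 1))) ∨
      ∃ s : ℝ, s < 0 ∧ (N.cycle c).node (i + 1) = s • (N.cycle c).node i := by
  have X := (N.cycle c).isLink hf h i
  rcases inner_eq_zero_or_exists_smul (hN c i) (hN c (i + 1)) ((N.cycle c).node_ne_zero i) with
    h0 | ⟨s, hs⟩
  · left
    -- Each node is reversed by the flip of the frame at the other one.
    obtain ⟨v, r, β, F, -, -⟩ := X.saddle
    obtain ⟨v', r', β', F', -, -⟩ := X.sink
    exact ⟨F'.isReversible F.base_mem h0,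
      F.isReversible F'.base_mem (by rw [real_inner_comm]; exact h0)⟩
  · right
    refine ⟨s, ?_, hs⟩
    rcases lt_trichotomy s 0 with hlt | rfl | hgt
    · exact hlt
    · exact absurd (by rw [hs, zero_smul]) ((N.cycle c).node_ne_zero (i + 1))
    · exact absurd (N.apply_node_eq_of_ray (γ := 1) (δ := 1) Γ.one_mem Γ.one_mem hgt hs).symm
        X.source_ne_target

/-- If a node is not reversible, then all nodes of a cycle that meets its axis lie on it. -/
theorem exists_node_eq_smul (N : SimpleNetwork Γ f) (hf : ContDiff ℝ 1 f)
    (h : IsEquivariant Γ f) (hN : ∀ c i, OnCoordinateAxis ((N.cycle c).node i)) {z : E4}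
    (hz : ¬ IsReversible Γ z) {c : Fin N.card} {i : ZMod (N.cycle c).len} {s : ℝ}
    (hi : (N.cycle c).node i = s • z) (j : ZMod (N.cycle c).len) :
    ∃ t : ℝ, (N.cycle c).node j = t • z ∧
      ∃ t' : ℝ, t * t' < 0 ∧ (N.cycle c).node (j + 1) = t' • z := by
  have : NeZero (N.cycle c).len := ⟨(N.cycle c).len_pos.ne'⟩
  have hstep : ∀ {j : ZMod (N.cycle c).len} {t : ℝ}, (N.cycle c).node j = t • z →
      ∃ t' : ℝ, t * t' < 0 ∧ (N.cycle c).node (j + 1) = t' • z := by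
    intro j t hj
    have ht : t ≠ 0 := by
      rintro rfl
      exact (N.cycle c).node_ne_zero j (by rw [hj, zero_smul])
    -- Reversibility is invariant under scaling, so a nonzero multiple of `z` is not reversible and
    -- the next node must be opposite.
    rcases N.isReversible_or_opposite hf h hN c j with ⟨hrev, -⟩ | ⟨u, hu, hju⟩
    · refine absurd ?_ hz
      have := hrev.smul t⁻¹
      rwa [hj, smul_smul, inv_mul_cancel₀ ht, one_smul] at this
    · refine ⟨u * t, ?_, by rw [hju, hj, smul_smul]⟩
      have : 0 < t ^ 2 := by positivity
      nlinarith
  have hall : ∀ n : ℕ, ∃ t : ℝ, (N.cycle c).node (i + n) = t • z := by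
    intro n
    induction n with
    | zero => exact ⟨s, by simpa using hi⟩
    | succ n ih =>
      obtain ⟨t, ht⟩ := ih
      obtain ⟨t', -, ht'⟩ := hstep ht
      exact ⟨t', by rw [← ht']; push_cast; rw [add_assoc]⟩
  obtain ⟨t, ht⟩ := hall (j - i).val
  rw [ZMod.natCast_val, ZMod.cast_id, add_sub_cancel] at ht
  exact ⟨t, ht, hstep ht⟩

/-- If some node is not reversible, all nodes of the network lie on its axis. -/
theorem exists_apply_node_eq_of_not_isReversible (N : SimpleNetwork Γ f) (hf : ContDiff ℝ 1 f)
    (h : IsEquivariant Γ f) (hN : ∀ c i, OnCoordinateAxis ((N.cycle c).node i))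
    {e : Fin N.card} {k : ZMod (N.cycle e).len} (hk : ¬ IsReversible Γ ((N.cycle e).node k))
    (c d : Fin N.card) : ∃ i j, ∃ γ ∈ Γ, γ ((N.cycle c).node i) = (N.cycle d).node j := by
  set z := (N.cycle e).node k with hz
  have hall : ∀ d : Fin N.card, ∃ (i : ZMod (N.cycle d).len) (s : ℝ),
      (N.cycle d).node i = s • z := by
    refine N.forall_of_exists hf (c := e) ⟨k, 1, by rw [one_smul]⟩ ?_
    rintro d e ⟨i, s, hi⟩ i' j' hij
    obtain ⟨t, ht, -⟩ := N.exists_node_eq_smul hf h hN hk hi i'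
    exact ⟨j', t, by rw [← hij, ht]⟩
  obtain ⟨i, s, hi⟩ := hall c
  obtain ⟨j, u, hj⟩ := hall d
  obtain ⟨t, ht, t', htt', ht'⟩ := N.exists_node_eq_smul hf h hN hk hi i
  have hu : u ≠ 0 := by
    rintro rfl
    exact (N.cycle d).node_ne_zero j (by rw [hj, zero_smul])
  have key : ∀ (i : ZMod (N.cycle c).len) (t : ℝ), (N.cycle c).node i = t • z → 0 < t * u →
      ∃ i j, ∃ γ ∈ Γ, γ ((N.cycle c).node i) = (N.cycle d).node j := by
    intro i t ht htu
    have hpos : 0 < t / u := by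
      rcases mul_pos_iff.1 htu with ⟨h1, h2⟩ | ⟨h1, h2⟩
      · exact div_pos h1 h2
      · exact div_pos_of_neg_of_neg h1 h2
    exact ⟨i, j, 1, Γ.one_mem, N.apply_node_eq_of_ray (γ := 1) (δ := 1) Γ.one_mem Γ.one_mem hpos
      (by
        change (N.cycle c).node i = (t / u) • (N.cycle d).node j
        rw [ht, hj, smul_smul, div_mul_cancel₀ _ hu])⟩
  -- Nodes `i` and `i + 1` are on opposite half-axes, so one of them is on the ray of node `j` of
  -- the other cycle.
  rcases lt_or_ge 0 (t * u) with hpos | hneg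
  · exact key i t ht hpos
  · refine key (i + 1) t' ht' ?_
    have hu2 : 0 < u ^ 2 := by positivity
    have h1 : (t * u) * (t' * u) < 0 := by nlinarith
    by_contra! hcon
    nlinarith [mul_nonneg_of_nonpos_of_nonpos hneg hcon]

/-- Nodes on the same axis are equivalent if one of them is reversible. -/
theorem exists_apply_node_eq_of_smul (N : SimpleNetwork Γ f) {c d : Fin N.card}
    {i : ZMod (N.cycle c).len} {j : ZMod (N.cycle d).len}
    (hrev : IsReversible Γ ((N.cycle c).node i)) {s : ℝ}
    (hs : (N.cycle c).node i = s • (N.cycle d).node j) :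
    ∃ γ ∈ Γ, γ ((N.cycle c).node i) = (N.cycle d).node j := by
  rcases lt_trichotomy s 0 with hlt | rfl | hgt
  · obtain ⟨γ, hγ, hneg⟩ := hrev
    refine ⟨γ, hγ, N.apply_node_eq_of_ray (δ := 1) hγ Γ.one_mem (neg_pos.2 hlt) ?_⟩
    rw [hneg, hs, neg_smul]
    rfl
  · exact absurd (by rw [hs, zero_smul]) ((N.cycle c).node_ne_zero i)
  · exact ⟨1, Γ.one_mem, N.apply_node_eq_of_ray (γ := 1) (δ := 1) Γ.one_mem Γ.one_mem hgt hs⟩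

/-- If all nodes are reversible, an elementary building block contains three pairwise orthogonal
nodes. -/
theorem exists_orthogonal_nodes (N : SimpleNetwork Γ f) (hf : ContDiff ℝ 1 f)
    (h : IsEquivariant Γ f) (hN : ∀ c i, OnCoordinateAxis ((N.cycle c).node i))
    (hrev : ∀ c i, IsReversible Γ ((N.cycle c).node i)) {c : Fin N.card}
    (hc : (N.cycle c).HasElementaryBuildingBlock) :
    ∃ n : Fin 3 → ZMod (N.cycle c).len, ∀ l l', l ≠ l' →
      inner ℝ ((N.cycle c).node (n l)) ((N.cycle c).node (n l')) = 0 := by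
  obtain ⟨i, k, ⟨hk1, -, hk, -⟩, hdist⟩ := hc
  -- Reversible nodes on one axis would be in the same orbit, which the elementary block forbids.
  have horth : ∀ l l' : ℕ, l < k → l' < k → l ≠ l' →
      inner ℝ ((N.cycle c).node (i + l)) ((N.cycle c).node (i + l')) = 0 := by
    intro l l' hl hl' hll
    rcases inner_eq_zero_or_exists_smul (hN c (i + l)) (hN c (i + l'))
      ((N.cycle c).node_ne_zero _) with h0 | ⟨s, hs⟩
    · exact h0
    · obtain ⟨γ, hγ, heq⟩ := N.exists_apply_node_eq_of_smul (hrev c _) hs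
      exact absurd ⟨γ, hγ, heq.symm⟩ (hdist l l' hl hl' hll)
  -- For `k = 1` a connection would join a node to itself. For `k = 2` node `i` would lie in both
  -- planes at node `i + 1`, hence on its line, although the two are orthogonal.
  have hk3 : 3 ≤ k := by
    by_contra! hlt
    interval_cases k
    · have := ((N.cycle c).isLink hf h i).source_ne_target
      simp only [Nat.cast_one] at hk
      exact this hk.symm
    · have h01 := horth 0 1 (by norm_num) (by norm_num) (by norm_num)
      simp only [Nat.cast_zero, add_zero, Nat.cast_one] at h01
      have hk' : (N.cycle c).node (i + 1 + 1) = (N.cycle c).node i := by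
        rw [add_assoc, one_add_one_eq_two]
        exact hk
      have hmem : (N.cycle c).node i ∈ (N.cycle c).plane (i + 1 - 1) ⊓ (N.cycle c).plane (i + 1) :=
        ⟨by rw [add_sub_cancel_right]; exact (N.cycle c).node_mem_plane i,
          hk' ▸ (N.cycle c).node_succ_mem_plane (i + 1)⟩
      rw [(N.cycle c).line_eq_span (i + 1), Submodule.mem_span_singleton] at hmem
      obtain ⟨s, hs⟩ := hmem
      have : inner ℝ ((N.cycle c).node i) ((N.cycle c).node i) = 0 := by
        nth_rewrite 2 [← hs]
        rw [inner_smul_right, h01, mul_zero]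
      exact (N.cycle c).node_ne_zero i (inner_self_eq_zero.1 this)
  exact ⟨fun l => i + (l : ℕ), fun l l' hll =>
    horth l l' (by omega) (by omega) fun h => hll (Fin.ext h)⟩

/-- If all nodes are reversible, any two cycles have a node in common up to symmetry: each of them
meets three of the four axes. -/
theorem exists_apply_node_eq_of_isReversible (N : SimpleNetwork Γ f) (hf : ContDiff ℝ 1 f)
    (h : IsEquivariant Γ f) (hA : N.AssumptionA)
    (hrev : ∀ c i, IsReversible Γ ((N.cycle c).node i)) (c d : Fin N.card) :
    ∃ i j, ∃ γ ∈ Γ, γ ((N.cycle c).node i) = (N.cycle d).node j := by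
  obtain ⟨n, hn⟩ := N.exists_orthogonal_nodes hf h hA.2 hrev (hA.1 c)
  obtain ⟨m, hm⟩ := N.exists_orthogonal_nodes hf h hA.2 hrev (hA.1 d)
  by_contra! hcon
  have hnm : ∀ l l', inner ℝ ((N.cycle c).node (n l)) ((N.cycle d).node (m l')) = 0 := by
    intro l l'
    rcases inner_eq_zero_or_exists_smul (hA.2 d (m l')) (hA.2 c (n l))
      ((N.cycle d).node_ne_zero _) with h0 | ⟨s, hs⟩
    · rw [real_inner_comm]; exact h0
    · obtain ⟨γ, hγ, heq⟩ := N.exists_apply_node_eq_of_smul (hrev c _) hs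
      exact absurd heq (hcon _ _ γ hγ)
  -- Without a common node, the two triples would be six nonzero pairwise orthogonal vectors in
  -- dimension four.
  have hli : LinearIndependent ℝ
      (Sum.elim (fun l => (N.cycle c).node (n l)) fun l => (N.cycle d).node (m l)) := by
    refine linearIndependent_of_ne_zero_of_inner_eq_zero (𝕜 := ℝ) ?_ ?_
    · rintro (l | l)
      exacts [(N.cycle c).node_ne_zero _, (N.cycle d).node_ne_zero _]
    · rintro (l | l) (l' | l') hll
      · exact hn l l' fun h => hll (by rw [h])
      · exact hnm l l'
      · exact (real_inner_comm _ _).trans (hnm l' l)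
      · exact hm l l' fun h => hll (by rw [h])
  have := hli.fintype_card_le_finrank
  simp at this

end SimpleNetwork

theorem mainTheorem2 (Γ : Subgroup O4) [Finite Γ] (f : E4 → E4) (hf : ContDiff ℝ 1 f)
    (hequiv : IsEquivariant Γ f) (N : SimpleNetwork Γ f) (hA : N.AssumptionA)
    (c d : Fin N.card) :
    HaveCommonConnection (N.cycle c).toHeteroclinicCycle (N.cycle d).toHeteroclinicCycle := by
  obtain ⟨i, j, γ, hγ, hij⟩ :
      ∃ i j, ∃ γ ∈ Γ, γ ((N.cycle c).node i) = (N.cycle d).node j := by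
    by_cases hrev : ∀ c i, IsReversible Γ ((N.cycle c).node i)
    · exact N.exists_apply_node_eq_of_isReversible hf hequiv hA hrev c d
    · push Not at hrev
      obtain ⟨e, k, hk⟩ := hrev
      exact N.exists_apply_node_eq_of_not_isReversible hf hequiv hA.2 hk c d
  exact N.haveCommonConnection_of_node hf hequiv hγ hij
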